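/- Let $\Omega\subset\mathbb{R}^3$ be a bounded open set with $C^\infty$ boundary $\Gamma=\partial\Omega$, let $a\in C^1(\overline\Omega)$ satisfy $0<a_0\le a(x)\le a_1$ for all $x\in\overline\Omega$, with constants $a_0,a_1$, and let $f,g:\mathbb{R}\to\mathbb{R}$ be $C^2$ functions such that, for $j=f$ and $j=g$, $\limsup_{|s|\to\infty} j(s)/s\le 0$ and $|j(s)|+|j'(s)|+|j''(s)|\le K$ for all $s\in\mathbb{R}$, for some constant $K>0$. Let $\gamma:H^1(\Omega)\to L^2(\Gamma)$ be the trace operator, and define for $u,w,\varphi\in H^1(\Omega)$ $$\langle\Lambda u,\varphi\rangle=\int_\Omega a\,\nabla u\cdot\nabla\varphi\,dx+\int_\Omega u\varphi\,dx,\qquad \langle F_0(u),\varphi\rangle=\int_\Omega f(u)\varphi\,dx+\int_\Gamma g(\gamma u)\,\gamma\varphi\,dS,$$ $$\langle DF_0(u)w,\varphi\rangle=\int_\Omega f'(u)w\varphi\,dx+\int_\Gamma g'(\gamma u)\,\gamma w\,\gamma\varphi\,dS .$$ Let $\mathcal{E}_0=\{u\in H^1(\Omega):\Lambda u-F_0(u)=0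 \text{ in } (H^1(\Omega))'\}$ be the set of weak solutions of $-\mathrm{div}(a\nabla u)+u=f(u)$ in $\Omega$, $a\,\partial u/\partial\vec n=g(u)$ on $\Gamma$. (1) If every point of $\mathcal{E}_0$ is isolated in $\mathcal{E}_0$ with respect to the $H^1(\Omega)$ topology, then $\mathcal{E}_0$ is finite. (2) If $0\notin\sigma(\Lambda-DF_0(u))$ for every $u\in\mathcal{E}_0$, where $\Lambda-DF_0(u)$ is regarded as an unbounded operator in $(H^1(\Omega))'$ with domain $H^1(\Omega)$ (so that the condition says that $\Lambda-DF_0(u):H^1(\Omega)\to(H^1(\Omega))'$ has a bounded inverse), then $\mathcal{E}_0$ is finite. -/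

import Mathlib

open MeasureTheory
open scoped ContDiff RealInnerProductSpace

namespace LimitEquilibria

noncomputable section

/-- The physical space `ℝ³` with its Euclidean norm. -/
abbrev R3 : Type := EuclideanSpace ℝ (Fin 3)

/-- `Ω ⊆ ℝ³` is a bounded open set with `C^∞` boundary: near each boundary point, after a rigid
change of the coordinate axes, `Ω` is the region strictly above the graph of a smooth function of
the first two coordinates. -/
structure IsSmoothBoundedDomain (Ω : Set R3) : Prop where
  isOpen : IsOpen Ω
  isBounded : Bornology.IsBounded Ω
  smooth_boundary : ∀ p ∈ frontier Ω, ∃ r > 0, ∃ T : R3 ≃ₗᵢ[ℝ] R3,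
    ∃ h : EuclideanSpace ℝ (Fin 2) → ℝ, ContDiff ℝ ∞ h ∧
      ∀ x ∈ Metric.ball p r, (x ∈ Ω ↔ h !₂[T x 0, T x 1] < T x 2)

/-- Real `L²(Ω)`, with Lebesgue measure. -/
abbrev L2 (Ω : Set R3) : Type := Lp ℝ 2 (volume.restrict Ω)

/-- `L²(Ω; ℝ³)`. -/
abbrev L2Vec (Ω : Set R3) : Type := Lp R3 2 (volume.restrict Ω)

/-- The surface measure `dS` on `Γ = ∂Ω`: the two-dimensional Hausdorff measure, normalized to
agree with area. -/
def surfaceMeasure (Ω : Set R3) : Measure R3 :=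
  (Measure.euclideanHausdorffMeasure 2 : Measure R3).restrict (frontier Ω)

/-- `L²(Γ)`. -/
abbrev L2Bdry (Ω : Set R3) : Type := Lp ℝ 2 (surfaceMeasure Ω)

/-- `G` is the weak (distributional) gradient of `u` in `Ω`:
`∫_Ω u ∂_v φ dx = - ∫_Ω (G · v) φ dx` for all test functions `φ ∈ C_c^∞(Ω)` and directions `v`. -/
def IsWeakGradient (Ω : Set R3) (u : L2 Ω) (G : L2Vec Ω) : Prop :=
  ∀ φ : R3 → ℝ, ContDiff ℝ ∞ φ → HasCompactSupport φ → tsupport φ ⊆ Ω → ∀ v : R3,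
    ∫ x in Ω, u x * fderiv ℝ φ x v = - ∫ x in Ω, ⟪G x, v⟫ * φ x

lemma integrable_mul_test {Ω : Set R3} (u : L2 Ω) {c : R3 → ℝ} (hc : Continuous c)
    (hs : HasCompactSupport c) : Integrable (fun x => u x * c x) (volume.restrict Ω) :=
  MemLp.integrable_mul (p := 2) (q := 2) (Lp.memLp u) (hc.memLp_of_hasCompactSupport hs)

lemma integrable_inner_mul_test {Ω : Set R3} (G : L2Vec Ω) (v : R3) {c : R3 → ℝ}
    (hc : Continuous c) (hs : HasCompactSupport c) :
    Integrable (fun x => ⟪G x, v⟫ * c x) (volume.restrict Ω) :=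
  MemLp.integrable_mul (p := 2) (q := 2) ((Lp.memLp G).inner_const v) (hc.memLp_of_hasCompactSupport hs)

lemma continuous_fderiv_test {φ : R3 → ℝ} (h : ContDiff ℝ ∞ φ) (v : R3) :
    Continuous (fun x => fderiv ℝ φ x v) :=
  (h.continuous_fderiv (by simp)).clm_apply continuous_const

lemma hasCompactSupport_fderiv_test {φ : R3 → ℝ} (h : HasCompactSupport φ) (v : R3) :
    HasCompactSupport (fun x => fderiv ℝ φ x v) :=
  h.fderiv_apply ℝ v

/-- The Sobolev space `H¹(Ω)`: the pairs `(u, ∇u) ∈ L²(Ω) × L²(Ω; ℝ³)` with `∇u` the weak gradient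
of `u` (which is determined by `u`). As a subspace of the Hilbert sum it carries the norm
`(‖u‖²_{L²} + ‖∇u‖²_{L²})^{1/2}`. -/
def H1 (Ω : Set R3) : Submodule ℝ (WithLp 2 (L2 Ω × L2Vec Ω)) where
  carrier := {w | IsWeakGradient Ω w.fst w.snd}
  zero_mem' := by
    intro φ _ _ _ v
    have h1 : (fun x => (0 : L2 Ω) x * fderiv ℝ φ x v) =ᵐ[volume.restrict Ω] fun _ => 0 := by
      filter_upwards [Lp.coeFn_zero ℝ 2 (volume.restrict Ω)] with x hx
      rw [hx]; simp
    have h2 : (fun x => ⟪(0 : L2Vec Ω) x, v⟫ * φ x) =ᵐ[volume.restrict Ω] fun _ => 0 := by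
      filter_upwards [Lp.coeFn_zero R3 2 (volume.restrict Ω)] with x hx
      rw [hx]; simp
    simp only [WithLp.zero_fst, WithLp.zero_snd]
    rw [integral_congr_ae h1, integral_congr_ae h2]
    simp
  add_mem' := by
    intro a b ha hb φ h1 h2 h3 v
    have e1 : (fun x => (a.fst + b.fst) x * fderiv ℝ φ x v) =ᵐ[volume.restrict Ω]
        fun x => a.fst x * fderiv ℝ φ x v + b.fst x * fderiv ℝ φ x v := by
      filter_upwards [Lp.coeFn_add a.fst b.fst] with x hx
      rw [hx, Pi.add_apply, add_mul]
    have e2 : (fun x => ⟪(a.snd + b.snd) x, v⟫ * φ x) =ᵐ[volume.restrict Ω]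
        fun x => ⟪a.snd x, v⟫ * φ x + ⟪b.snd x, v⟫ * φ x := by
      filter_upwards [Lp.coeFn_add a.snd b.snd] with x hx
      rw [hx, Pi.add_apply, inner_add_left, add_mul]
    have c1 := continuous_fderiv_test h1 v
    have s1 := hasCompactSupport_fderiv_test h2 v
    simp only [WithLp.add_fst, WithLp.add_snd]
    rw [integral_congr_ae e1, integral_congr_ae e2,
      integral_add (integrable_mul_test _ c1 s1) (integrable_mul_test _ c1 s1),
      integral_add (integrable_inner_mul_test _ v h1.continuous h2)
        (integrable_inner_mul_test _ v h1.continuous h2),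
      ha φ h1 h2 h3 v, hb φ h1 h2 h3 v]
    ring
  smul_mem' := by
    intro c a ha φ h1 h2 h3 v
    have e1 : (fun x => (c • a.fst) x * fderiv ℝ φ x v) =ᵐ[volume.restrict Ω]
        fun x => c * (a.fst x * fderiv ℝ φ x v) := by
      filter_upwards [Lp.coeFn_smul c a.fst] with x hx
      rw [hx, Pi.smul_apply, smul_eq_mul, mul_assoc]
    have e2 : (fun x => ⟪(c • a.snd) x, v⟫ * φ x) =ᵐ[volume.restrict Ω]
        fun x => c * (⟪a.snd x, v⟫ * φ x) := by
      filter_upwards [Lp.coeFn_smul c a.snd] with x hx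
      rw [hx, Pi.smul_apply, real_inner_smul_left, mul_assoc]
    simp only [WithLp.smul_fst, WithLp.smul_snd]
    rw [integral_congr_ae e1, integral_congr_ae e2, integral_const_mul, integral_const_mul,
      ha φ h1 h2 h3 v]
    ring

/-- The function underlying an element of `H¹(Ω)`. -/
def fn {Ω : Set R3} (u : H1 Ω) : L2 Ω := (u : WithLp 2 (L2 Ω × L2Vec Ω)).fst

/-- The weak gradient of an element of `H¹(Ω)`. -/
def grad {Ω : Set R3} (u : H1 Ω) : L2Vec Ω := (u : WithLp 2 (L2 Ω × L2Vec Ω)).snd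

/-- The dual space `(H¹(Ω))'`. -/
abbrev H1Dual (Ω : Set R3) : Type := H1 Ω →L[ℝ] ℝ

/-- `γ : H¹(Ω) → L²(Γ)` is bounded, linear, and restricts functions that are `C¹` up to the
boundary to `Γ`. -/
def IsTraceOperator (Ω : Set R3) (γ : H1 Ω →L[ℝ] L2Bdry Ω) : Prop :=
  ∀ φ : R3 → ℝ, ContDiff ℝ 1 φ → ∀ u : H1 Ω,
    (∀ᵐ x ∂(volume.restrict Ω), fn u x = φ x) → ∀ᵐ x ∂(surfaceMeasure Ω), γ u x = φ x

open Classical in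
/-- The trace operator `γ : H¹(Ω) → L²(Γ)`. On a bounded smooth domain there is exactly one operator
as in `IsTraceOperator` (boundary estimate, and density of the functions that are `C¹` up to the
boundary); for other sets without such an operator the value is `0` by convention. -/
def trace (Ω : Set R3) : H1 Ω →L[ℝ] L2Bdry Ω :=
  if h : ∃ γ, IsTraceOperator Ω γ then h.choose else 0

/-- The hypotheses on a nonlinearity `j`: it is `C²`, dissipative, that is
`limsup_{|s| → ∞} j(s)/s ≤ 0`, and bounded together with its first two derivatives. -/
structure IsAdmissible (j : ℝ → ℝ) : Prop where
  contDiff : ContDiff ℝ 2 j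
  dissipative : Filter.limsup (fun s : ℝ => ((j s / s : ℝ) : EReal)) (Filter.cocompact ℝ) ≤ 0
  bounded : ∃ K > 0, ∀ s, |j s| + |deriv j s| + |iteratedDeriv 2 j s| ≤ K

/-- The functional `Λ u ∈ (H¹(Ω))'`, `⟨Λ u, φ⟩ = ∫_Ω a ∇u·∇φ dx + ∫_Ω u φ dx`. -/
def Lam {Ω : Set R3} (a : R3 → ℝ) (u φ : H1 Ω) : ℝ :=
  (∫ x in Ω, a x * ⟪grad u x, grad φ x⟫) + ∫ x in Ω, fn u x * fn φ x

/-- The functional `F₀(u) ∈ (H¹(Ω))'`, `⟨F₀(u), φ⟩ = ∫_Ω f(u) φ dx + ∫_Γ g(u) φ dS`, where boundary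
values are taken in the sense of traces. -/
def F0 {Ω : Set R3} (f g : ℝ → ℝ) (u φ : H1 Ω) : ℝ :=
  (∫ x in Ω, f (fn u x) * fn φ x) +
    ∫ x, g (trace Ω u x) * trace Ω φ x ∂(surfaceMeasure Ω)

/-- The functional `DF₀(u) w ∈ (H¹(Ω))'`,
`⟨DF₀(u) w, φ⟩ = ∫_Ω f'(u) w φ dx + ∫_Γ g'(u) w φ dS`. -/
def DF0 {Ω : Set R3} (f g : ℝ → ℝ) (u w φ : H1 Ω) : ℝ :=
  (∫ x in Ω, deriv f (fn u x) * fn w x * fn φ x) +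
    ∫ x, deriv g (trace Ω u x) * trace Ω w x * trace Ω φ x ∂(surfaceMeasure Ω)

/-- The set `𝓔₀ = {u ∈ H¹(Ω) : Λ u - F₀(u) = 0}` of (weak) solutions of
`-div(a ∇u) + u = f(u)` in `Ω`, `a ∂u/∂n = g(u)` on `Γ`. -/
def solutionSet (Ω : Set R3) (a : R3 → ℝ) (f g : ℝ → ℝ) : Set (H1 Ω) :=
  {u | ∀ φ : H1 Ω, Lam a u φ - F0 f g u φ = 0}

/-- The resolvent set (real points) of an operator `B` with domain `H¹(Ω)` and values in
`(H¹(Ω))'`, viewed as an unbounded operator in `(H¹(Ω))'`, where `H¹(Ω) ⊆ (H¹(Ω))'` through the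
`L²(Ω)` pairing: `lam` belongs to it iff `lam - B` has a bounded everywhere defined two-sided
inverse `R : (H¹(Ω))' → H¹(Ω)`. Here `B w φ` stands for `⟨B w, φ⟩`. -/
def resolvent (Ω : Set R3) (B : H1 Ω → H1 Ω → ℝ) : Set ℝ :=
  {lam | ∃ R : H1Dual Ω →L[ℝ] H1 Ω,
    (∀ (l : H1Dual Ω) (φ : H1 Ω),
      lam * (∫ x in Ω, fn (R l) x * fn φ x) - B (R l) φ = l φ) ∧
    ∀ (l : H1Dual Ω) (w : H1 Ω),
      (∀ φ : H1 Ω, lam * (∫ x in Ω, fn w x * fn φ x) - B w φ = l φ) → R l = w}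

/-- The (real part of the) spectrum: the complement of the resolvent set. -/
def spectrumOf (Ω : Set R3) (B : H1 Ω → H1 Ω → ℝ) : Set ℝ := (resolvent Ω B)ᶜ

/-- The linearization `Λ - DF₀(u)` at `u`, as `w ↦ (φ ↦ ⟨(Λ - DF₀(u)) w, φ⟩)`. -/
def linearization {Ω : Set R3} (a : R3 → ℝ) (f g : ℝ → ℝ) (u : H1 Ω) (w φ : H1 Ω) : ℝ :=
  Lam a w φ - DF0 f g u w φ

/-- `u ∈ S` is an isolated point of `S ⊆ H¹(Ω)`: it is the only point of `S` in some ball. -/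
def IsIsolatedIn {Ω : Set R3} (S : Set (H1 Ω)) (u : H1 Ω) : Prop :=
  ∃ δ > 0, S ∩ Metric.ball u δ = {u}

end

end LimitEquilibria

/-!
The set `𝓔₀` of weak solutions is compact in `H¹(Ω)`, so it is finite as soon as its points are
isolated. Both the compactness of `𝓔₀` and the passage from an invertible linearization to an
isolated point rest on one fact (`totallyBounded_of_abs_le`): the `w ∈ H¹(Ω)` for which `Λ w` is
bounded by `M` as a functional on `L²(Ω) × L²(Γ)` form a totally bounded set. Solutions are of this
kind because `f` and `g` are bounded. The normalized differences
`wₙ = (vₙ - u) / ‖vₙ - u‖` of solutions `vₙ → u` are of this kind because `f` and `g` are Lipschitz;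
a limit point of the `wₙ` has norm `1` and lies in the kernel of `Λ - DF₀(u)`. The limit equation is
tested with functions that are `C¹` up to the boundary only. These are bounded, so the second order
Taylor estimate of `f` and `g` makes the remainder quadratic in `‖vₙ - u‖` without any Sobolev
embedding, and they are dense (`topologicalClosure_restrictC1`).

Total boundedness follows from coercivity of `Λ` and two inequalities in `H¹(Ω)`, valid for every
`ε > 0`:
* `norm_trace_sq_le`: `‖γ u‖² ≤ C ‖u‖²_{L²} + ε ‖u‖²_{H¹}`;
* `exists_compactness_estimate`: `‖u‖²_{L²} ≤ C ∑ ⟨g, u⟩² + ε ‖u‖²_{H¹}` with finitely many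
  `g ∈ L²(Ω)`, a quantitative form of Rellich's theorem.

Both are proved for `C¹` functions and extended by density. The domain enters through the uniform
interior cone property (`exists_cone`): near each point of the closure there is a direction `e` such
that the balls of radius `c t` about `x + t e` lie in `Ω`. Means of `u` over these balls are compact
functions of `u` and differ from `u` by `O(t ‖∇u‖)` in `L²`, which gives the second inequality;
mollifying with a kernel supported in such a ball turns `u` into a smooth function on all of `ℝ³`,
which gives the density. For the first one, `|u(x)|²` is averaged along the segments
`x + t e`, `0 < t ≤ δ`, that start on `Γ`; only an upper bound of the surface measure is needed, and
it comes from the Lipschitz parametrization of `Γ` by a graph. If no trace operator existed, `trace`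
would be `0` by convention and the first inequality trivial, so the existence of traces is not an
ingredient.
-/

namespace LimitEquilibria

noncomputable section

/-! ### Increments, translations and averages in `L²` -/

/-- The Cauchy-Schwarz inequality against the constant function `1`. -/
lemma sq_lintegral_le_mul {α : Type*} [MeasurableSpace α] (ν : Measure α)
    {f : α → ENNReal} (hf : AEMeasurable f ν) :
    (∫⁻ y, f y ∂ν) ^ 2 ≤ ν Set.univ * ∫⁻ y, f y ^ 2 ∂ν := by
  have h := ENNReal.lintegral_mul_le_Lp_mul_Lq ν (p := 2) (q := 2)
    Real.HolderConjugate.two_two hf (aemeasurable_const (b := (1 : ENNReal)))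
  simp only [Pi.mul_apply, mul_one, ENNReal.one_rpow, lintegral_const, one_mul] at h
  calc (∫⁻ y, f y ∂ν) ^ 2
      ≤ ((∫⁻ y, f y ^ (2 : ℝ) ∂ν) ^ (1 / 2 : ℝ) * ν Set.univ ^ (1 / 2 : ℝ)) ^ 2 := by gcongr
    _ = ν Set.univ * ∫⁻ y, f y ^ (2 : ℝ) ∂ν := by
      rw [mul_pow, ← ENNReal.rpow_natCast, ← ENNReal.rpow_mul, ← ENNReal.rpow_natCast,
        ← ENNReal.rpow_mul, mul_comm]
      norm_num
    _ = _ := by simp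

lemma sq_lintegral_le {α : Type*} [MeasurableSpace α] (ν : Measure α) [IsProbabilityMeasure ν]
    {f : α → ENNReal} (hf : AEMeasurable f ν) : (∫⁻ y, f y ∂ν) ^ 2 ≤ ∫⁻ y, f y ^ 2 ∂ν := by
  simpa using sq_lintegral_le_mul ν hf

lemma enorm_add_sq_le {E : Type*} [SeminormedAddCommGroup E] (x y : E) :
    ‖x + y‖ₑ ^ 2 ≤ 2 * ‖x‖ₑ ^ 2 + 2 * ‖y‖ₑ ^ 2 := by
  have h : ‖x + y‖ ^ 2 ≤ 2 * ‖x‖ ^ 2 + 2 * ‖y‖ ^ 2 := by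
    nlinarith [norm_add_le x y, norm_nonneg (x + y), sq_nonneg (‖x‖ - ‖y‖), norm_nonneg x,
      norm_nonneg y]
  have := ENNReal.ofReal_le_ofReal h
  rw [ENNReal.ofReal_add (by positivity) (by positivity), ENNReal.ofReal_mul (by norm_num),
    ENNReal.ofReal_mul (by norm_num)] at this
  simpa [ENNReal.ofReal_pow, ofReal_norm] using this

lemma lintegral_enorm_sq_eq {α E : Type*} [MeasurableSpace α] {μ : Measure α}
    [NormedAddCommGroup E] (f : α → E) : ∫⁻ x, ‖f x‖ₑ ^ 2 ∂μ = eLpNorm f 2 μ ^ 2 := by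
  have h := eLpNorm_nnreal_pow_eq_lintegral (f := f) (μ := μ) (p := 2) (by norm_num)
  simpa using h.symm

lemma lintegral_enorm_sq_Lp {α E : Type*} [MeasurableSpace α] {μ : Measure α}
    [NormedAddCommGroup E] (f : Lp E 2 μ) : ∫⁻ x, ‖f x‖ₑ ^ 2 ∂μ = ENNReal.ofReal (‖f‖ ^ 2) := by
  rw [lintegral_enorm_sq_eq, ← Lp.enorm_def, ENNReal.ofReal_pow (norm_nonneg _), ofReal_norm]

/-- The increment of a `C¹` function is controlled by the gradient along the segment. -/
lemma enorm_sub_sq_le_segment {φ : R3 → ℝ} (hφ : ContDiff ℝ 1 φ) (x y : R3) {t : ℝ}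
    (ht : 0 ≤ t) : ‖φ (x + t • y) - φ x‖ₑ ^ 2 ≤
      ENNReal.ofReal t * ‖y‖ₑ ^ 2 * ∫⁻ s in Set.Ioc (0 : ℝ) t, ‖fderiv ℝ φ (x + s • y)‖ₑ ^ 2 := by
  have hc : Continuous fun s : ℝ => fderiv ℝ φ (x + s • y) :=
    (hφ.continuous_fderiv (by simp)).comp (by fun_prop)
  have hd : ∀ s : ℝ, HasDerivAt (fun s : ℝ => φ (x + s • y)) (fderiv ℝ φ (x + s • y) y) s := by
    intro s
    have h1 := ((hφ.differentiable (by simp)) (x + s • y)).hasFDerivAt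
    have h2 : HasDerivAt (fun s : ℝ => x + s • y) y s := by
      simpa using ((hasDerivAt_id s).smul_const y).const_add x
    exact h1.comp_hasDerivAt s h2
  have hint : ∫ s in (0 : ℝ)..t, fderiv ℝ φ (x + s • y) y = φ (x + t • y) - φ x := by
    have h := intervalIntegral.integral_eq_sub_of_hasDerivAt (a := 0) (b := t)
      (fun s _ => hd s) ((hc.clm_apply continuous_const).intervalIntegrable _ _)
    simpa using h
  rw [← hint, intervalIntegral.integral_of_le ht]
  calc _ ≤ (∫⁻ s in Set.Ioc (0 : ℝ) t, ‖y‖ₑ * ‖fderiv ℝ φ (x + s • y)‖ₑ) ^ 2 := by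
        gcongr
        refine (enorm_integral_le_lintegral_enorm _).trans (lintegral_mono fun s => ?_)
        rw [mul_comm]
        exact ContinuousLinearMap.le_opENorm _ _
    _ ≤ _ := sq_lintegral_le_mul _ (by fun_prop)
    _ = _ := by
        simp_rw [mul_pow]
        rw [lintegral_const_mul _ (by fun_prop)]
        simp [mul_assoc]

/-- If all the segments `[x, x + y]`, `x ∈ A`, stay in `Ω` (except for `x` itself), the translation
by `y` changes a `C¹` function by at most `‖y‖ ‖∇φ‖` in `L²(A)`. -/
lemma lintegral_translate_sub_le {φ : R3 → ℝ} (hφ : ContDiff ℝ 1 φ) {A Ω : Set R3}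
    (hA : MeasurableSet A) (hΩ : MeasurableSet Ω) (y : R3)
    (h : ∀ x ∈ A, ∀ s ∈ Set.Ioc (0 : ℝ) 1, x + s • y ∈ Ω) :
    ∫⁻ x in A, ‖φ (x + y) - φ x‖ₑ ^ 2 ≤ ‖y‖ₑ ^ 2 * ∫⁻ x in Ω, ‖fderiv ℝ φ x‖ₑ ^ 2 := by
  have hc := hφ.continuous_fderiv (by simp)
  calc _ ≤ ∫⁻ x in A, ‖y‖ₑ ^ 2 *
          ∫⁻ s in Set.Ioc (0 : ℝ) 1, ‖fderiv ℝ φ (x + s • y)‖ₑ ^ 2 :=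
        lintegral_mono fun x => by simpa using enorm_sub_sq_le_segment hφ x y zero_le_one
    _ = ‖y‖ₑ ^ 2 * ∫⁻ x in A, ∫⁻ s in Set.Ioc (0 : ℝ) 1, ‖fderiv ℝ φ (x + s • y)‖ₑ ^ 2 :=
        lintegral_const_mul' _ _ (by simp)
    _ = ‖y‖ₑ ^ 2 * ∫⁻ s in Set.Ioc (0 : ℝ) 1, ∫⁻ x in A, ‖fderiv ℝ φ (x + s • y)‖ₑ ^ 2 := by
        rw [lintegral_lintegral_swap]
        refine Measurable.aemeasurable (Continuous.measurable ?_)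
        simp only [Function.uncurry_def]
        have : Continuous fun p : R3 × ℝ => fderiv ℝ φ (p.1 + p.2 • y) :=
          hc.comp (by fun_prop)
        fun_prop
    _ ≤ ‖y‖ₑ ^ 2 * ∫⁻ s in Set.Ioc (0 : ℝ) 1, ∫⁻ x in Ω, ‖fderiv ℝ φ x‖ₑ ^ 2 := by
        gcongr 1
        refine setLIntegral_mono' measurableSet_Ioc fun s hs => ?_
        rw [← lintegral_indicator hA, ← lintegral_indicator hΩ,
          ← lintegral_add_right_eq_self (Ω.indicator fun x => ‖fderiv ℝ φ x‖ₑ ^ 2) (s • y)]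
        refine lintegral_mono fun x => ?_
        by_cases hx : x ∈ A
        · simp [hx, h x hx s hs]
        · simp [hx]
    _ = _ := by simp

/-- Continuity of translations in `L²(ℝ³; E)`. -/
lemma exists_lintegral_translate_sub_le {E : Type*} [NormedAddCommGroup E] {G : R3 → E}
    (hG : MemLp G 2 volume) {ε : ENNReal} (hε : 0 < ε) :
    ∃ ρ > 0, ∀ y : R3, ‖y‖ < ρ → ∫⁻ x, ‖G (x + y) - G x‖ₑ ^ 2 ≤ ε := by
  obtain ⟨η, hη0, hη⟩ : ∃ η : ENNReal, 0 < η ∧ η ^ 2 < ε := by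
    have h : Filter.Tendsto (fun η : ENNReal => η ^ 2) (nhds 0) (nhds 0) := by
      simpa using (ENNReal.continuous_pow 2).tendsto 0
    have h2 := (h.eventually (gt_mem_nhds hε)).filter_mono
      (nhdsWithin_le_nhds (s := Set.Ioi 0))
    have h3 := h2.and (self_mem_nhdsWithin (a := (0 : ENNReal)) (s := Set.Ioi 0))
    obtain ⟨η, h4, h5⟩ := h3.exists
    exact ⟨η, h5, h4⟩
  let g : C(R3, C(R3, R3)) :=
    (ContinuousMap.mk (fun a : R3 × R3 => a.2 + a.1) (by fun_prop)).curry
  have hgm : ∀ y, MeasurePreserving (g y) volume volume := fun y =>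
    measurePreserving_add_right volume y
  have hcont : Continuous fun y => Lp.compMeasurePreserving (g y) (hgm y) (hG.toLp G) :=
    continuous_const.compMeasurePreservingLp g.continuous hgm (by norm_num)
  have h0 := EMetric.tendsto_nhds.1 (hcont.tendsto 0) η hη0
  obtain ⟨ρ, hρ, hb⟩ := Metric.eventually_nhds_iff.1 h0
  refine ⟨ρ, hρ, fun y hy => ?_⟩
  have h1 := hb (y := y) (by simpa using hy)
  rw [Lp.toLp_compMeasurePreserving, Lp.toLp_compMeasurePreserving, Lp.edist_toLp_toLp] at h1
  rw [lintegral_enorm_sq_eq]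
  refine le_trans ?_ hη.le
  have h2 : (G ∘ (g y) - G ∘ (g 0)) = fun x => G (x + y) - G x := by
    funext x; simp [g]
  rw [← h2]
  gcongr

/-- If the translations by `ν`-almost every `y` change `G` by at most `ε` in (squared) `L²(A)`, so
does the averaging over `y`: Jensen's inequality and Tonelli's theorem. -/
lemma lintegral_average_sub_le {E : Type*} [NormedAddCommGroup E] [NormedSpace ℝ E]
    (ν : Measure R3) [IsProbabilityMeasure ν] {G : R3 → E} (hG : StronglyMeasurable G)
    {A : Set R3} {ε : ENNReal}
    (h : ∀ᵐ y ∂ν, ∫⁻ x in A, ‖G (x + y) - G x‖ₑ ^ 2 ≤ ε) :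
    ∫⁻ x in A, ‖∫ y, (G (x + y) - G x) ∂ν‖ₑ ^ 2 ≤ ε := by
  have hm : Measurable fun p : R3 × R3 => ‖G (p.1 + p.2) - G p.1‖ₑ ^ 2 := by
    have h1 : StronglyMeasurable fun p : R3 × R3 => G (p.1 + p.2) - G p.1 :=
      (hG.comp_measurable (by fun_prop)).sub (hG.comp_measurable measurable_fst)
    exact h1.enorm.pow_const 2
  calc _ ≤ ∫⁻ x in A, ∫⁻ y, ‖G (x + y) - G x‖ₑ ^ 2 ∂ν := by
        refine lintegral_mono fun x => ?_
        refine le_trans ?_ (sq_lintegral_le ν ?_)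
        · gcongr
          exact enorm_integral_le_lintegral_enorm _
        · have h1 : StronglyMeasurable fun y => G (x + y) - G x :=
            (hG.comp_measurable (by fun_prop)).sub stronglyMeasurable_const
          exact h1.enorm.aemeasurable
    _ = ∫⁻ y, (∫⁻ x in A, ‖G (x + y) - G x‖ₑ ^ 2) ∂ν := by
        rw [lintegral_lintegral_swap]
        exact hm.aemeasurable
    _ ≤ ∫⁻ _, ε ∂ν := lintegral_mono_ae h
    _ = ε := by simp

/-! ### Boundary charts, cones and the surface measure -/

/-- The first two coordinates of `x` after the change of axes `T`. -/
def planeProj (T : R3 ≃ₗᵢ[ℝ] R3) (x : R3) : EuclideanSpace ℝ (Fin 2) :=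
  !₂[T x 0, T x 1]

/-- The unit vector of the third axis, before the change of axes `T`. -/
def upDir (T : R3 ≃ₗᵢ[ℝ] R3) : R3 := T.symm (EuclideanSpace.single 2 1)

lemma norm_upDir (T : R3 ≃ₗᵢ[ℝ] R3) : ‖upDir T‖ = 1 := by simp [upDir]

lemma planeProj_add (T : R3 ≃ₗᵢ[ℝ] R3) (x y : R3) :
    planeProj T (x + y) = planeProj T x + planeProj T y := by
  ext i; fin_cases i <;> simp [planeProj]

lemma planeProj_sub (T : R3 ≃ₗᵢ[ℝ] R3) (x y : R3) :
    planeProj T (x - y) = planeProj T x - planeProj T y := by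
  ext i; fin_cases i <;> simp [planeProj]

lemma planeProj_smul_upDir (T : R3 ≃ₗᵢ[ℝ] R3) (t : ℝ) : planeProj T (t • upDir T) = 0 := by
  ext i; fin_cases i <;> simp [planeProj, upDir]

lemma norm_sq_eq_planeProj (T : R3 ≃ₗᵢ[ℝ] R3) (x : R3) :
    ‖x‖ ^ 2 = ‖planeProj T x‖ ^ 2 + (T x 2) ^ 2 := by
  rw [← T.norm_map x, EuclideanSpace.norm_sq_eq, EuclideanSpace.norm_sq_eq]
  simp [Fin.sum_univ_three, planeProj]

lemma norm_planeProj_le (T : R3 ≃ₗᵢ[ℝ] R3) (x : R3) : ‖planeProj T x‖ ≤ ‖x‖ := by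
  nlinarith [norm_sq_eq_planeProj T x, norm_nonneg x, norm_nonneg (planeProj T x),
    sq_nonneg (T x 2)]

lemma abs_apply_two_le (T : R3 ≃ₗᵢ[ℝ] R3) (x : R3) : |T x 2| ≤ ‖x‖ := by
  refine abs_le_of_sq_le_sq ?_ (norm_nonneg x)
  nlinarith [norm_sq_eq_planeProj T x, sq_nonneg ‖planeProj T x‖]

lemma continuous_planeProj (T : R3 ≃ₗᵢ[ℝ] R3) : Continuous (planeProj T) := by
  refine (LipschitzWith.of_dist_le_mul (K := 1) fun x y => ?_).continuous
  rw [dist_eq_norm, dist_eq_norm, ← planeProj_sub]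
  simpa using norm_planeProj_le T (x - y)

/-- A boundary chart with a Lipschitz graph. -/
lemma IsSmoothBoundedDomain.exists_chart {Ω : Set R3} (hΩ : IsSmoothBoundedDomain Ω) {p : R3}
    (hp : p ∈ frontier Ω) : ∃ r > 0, ∃ (T : R3 ≃ₗᵢ[ℝ] R3) (h : EuclideanSpace ℝ (Fin 2) → ℝ)
      (K : NNReal), Continuous h ∧ LipschitzOnWith K h (Metric.ball (planeProj T p) r) ∧
      (∀ x ∈ Metric.ball p r, planeProj T x ∈ Metric.ball (planeProj T p) r) ∧
      (∀ x ∈ Metric.ball p r, h (planeProj T x) < T x 2 → x ∈ Ω) ∧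
      (∀ x ∈ closure Ω ∩ Metric.ball p r, h (planeProj T x) ≤ T x 2) ∧
      ∀ x ∈ frontier Ω ∩ Metric.ball p r, h (planeProj T x) = T x 2 := by
  obtain ⟨r, hr, T, h, hh, H⟩ := hΩ.smooth_boundary p hp
  have hloc : LocallyLipschitz h := (hh.of_le (by simp)).locallyLipschitz
  obtain ⟨K, hK⟩ := hloc.locallyLipschitzOn.exists_lipschitzOnWith_of_compact
    (isCompact_closedBall (planeProj T p) r)
  have hcl : ∀ x ∈ closure Ω ∩ Metric.ball p r, h (planeProj T x) ≤ T x 2 := by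
    rintro x ⟨hx, hxr⟩
    have hc : IsClosed {x | h (planeProj T x) ≤ T x 2} :=
      isClosed_le (hh.continuous.comp (continuous_planeProj T)) (by fun_prop)
    have hx' : x ∈ closure (Ω ∩ Metric.ball p r) :=
      closure_mono (Set.inter_comm _ _).le (Metric.isOpen_ball.inter_closure ⟨hxr, hx⟩)
    exact closure_minimal (fun y hy => ((H y hy.2).1 hy.1).le) hc hx'
  refine ⟨r, hr, T, h, K, hh.continuous, hK.mono Metric.ball_subset_closedBall, ?_,
    fun x hx => (H x hx).2, hcl, ?_⟩
  · intro x hx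
    rw [Metric.mem_ball, dist_eq_norm] at hx ⊢
    rw [← planeProj_sub]
    exact (norm_planeProj_le T _).trans_lt hx
  · rintro x ⟨hx, hxr⟩
    refine le_antisymm (hcl x ⟨frontier_subset_closure hx, hxr⟩) (not_lt.1 fun hlt => ?_)
    rw [hΩ.isOpen.frontier_eq] at hx
    exact hx.2 ((H x hxr).2 hlt)

/-- Near `p`, the set `Ω` contains, for each point `x` of its closure, a truncated cone with vertex
`x` and axis `e`, without its vertex. The cone is given as the union of the balls of radius `c * t`
about `x + t • e`, for `0 < t ≤ s`; for an interior point `p` the choice `e = 0` is allowed. -/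
def HasInnerCone (Ω : Set R3) (p e : R3) (r c s : ℝ) : Prop :=
  ∀ x ∈ closure Ω ∩ Metric.ball p r, ∀ t ∈ Set.Ioc 0 s,
    Metric.closedBall (x + t • e) (c * t) ⊆ Ω

/-- Above a `K`-Lipschitz graph, cones of opening `1 / (K + 2)` around the upward direction fit. -/
lemma hasInnerCone_of_chart {Ω : Set R3} {p : R3} {r : ℝ} (hr : 0 < r) {T : R3 ≃ₗᵢ[ℝ] R3}
    {h : EuclideanSpace ℝ (Fin 2) → ℝ} {K : NNReal}
    (hK : LipschitzOnWith K h (Metric.ball (planeProj T p) r))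
    (hpr : ∀ x ∈ Metric.ball p r, planeProj T x ∈ Metric.ball (planeProj T p) r)
    (hin : ∀ x ∈ Metric.ball p r, h (planeProj T x) < T x 2 → x ∈ Ω)
    (hcl : ∀ x ∈ closure Ω ∩ Metric.ball p r, h (planeProj T x) ≤ T x 2) :
    HasInnerCone Ω p (upDir T) (r / 2) (1 / (K + 2)) (r / 4) := by
  rintro x ⟨hx, hxr⟩ t ⟨ht0, ht⟩ y hy
  set c : ℝ := 1 / (K + 2) with hc
  have hK0 : (0 : ℝ) ≤ K := K.2
  have hc0 : 0 < c := by positivity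
  have hcK : c * (K + 2) = 1 := by rw [hc]; field_simp
  have hc1 : c < 1 := by nlinarith
  obtain ⟨z, rfl⟩ : ∃ z, y = x + t • upDir T + z := ⟨y - (x + t • upDir T), by abel⟩
  have hz : ‖z‖ ≤ c * t := by simpa [dist_eq_norm] using hy
  rw [Metric.mem_ball, dist_eq_norm] at hxr
  have hxb : x ∈ Metric.ball p r := by rw [Metric.mem_ball, dist_eq_norm]; linarith
  have hyb : x + t • upDir T + z ∈ Metric.ball p r := by
    rw [Metric.mem_ball, dist_eq_norm]
    calc ‖x + t • upDir T + z - p‖ = ‖(x - p) + (t • upDir T + z)‖ := by congr 1; abel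
      _ ≤ ‖x - p‖ + (‖t • upDir T‖ + ‖z‖) :=
        (norm_add_le _ _).trans (by gcongr; exact norm_add_le _ _)
      _ < r := by
        rw [norm_smul, norm_upDir, Real.norm_of_nonneg ht0.le]
        nlinarith
  refine hin _ hyb ?_
  have h1 : |h (planeProj T (x + t • upDir T + z)) - h (planeProj T x)| ≤ K * ‖z‖ := by
    have := hK.dist_le_mul _ (hpr _ hyb) _ (hpr _ hxb)
    rw [Real.dist_eq, dist_eq_norm, ← planeProj_sub] at this
    refine this.trans ?_
    gcongr
    have e1 : planeProj T (x + t • upDir T + z - x) = planeProj T z := by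
      rw [show x + t • upDir T + z - x = t • upDir T + z by abel, planeProj_add,
        planeProj_smul_upDir, zero_add]
    rw [e1]
    exact norm_planeProj_le T z
  have h2 : T (x + t • upDir T + z) 2 = T x 2 + t + T z 2 := by simp [upDir]
  have h3 := abs_apply_two_le T z
  have h4 := hcl x ⟨hx, hxb⟩
  rw [h2]
  have h5 := (abs_le.1 h1).2
  have h6 := (abs_le.1 h3).1
  have h7 : (K : ℝ) * ‖z‖ ≤ K * (c * t) := by gcongr
  nlinarith

/-- The uniform interior cone property of a smooth bounded domain. -/
lemma IsSmoothBoundedDomain.exists_cone {Ω : Set R3} (hΩ : IsSmoothBoundedDomain Ω) {p : R3}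
    (hp : p ∈ closure Ω) : ∃ r > 0, ∃ c > 0, ∃ s > 0, ∃ e : R3, ‖e‖ ≤ 1 ∧ c ≤ 1 ∧
      HasInnerCone Ω p e r c s := by
  by_cases hpΩ : p ∈ Ω
  · obtain ⟨r, hr, hb⟩ := Metric.isOpen_iff.1 hΩ.isOpen p hpΩ
    refine ⟨r / 2, by positivity, 1, one_pos, r / 4, by positivity, 0, by simp, le_rfl, ?_⟩
    rintro x ⟨-, hx⟩ t ⟨ht0, ht⟩ y hy
    refine hb ?_
    rw [Metric.mem_ball] at hx ⊢
    rw [Metric.mem_closedBall, smul_zero, add_zero] at hy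
    linarith [dist_triangle y x p]
  · have hpf : p ∈ frontier Ω := by rw [hΩ.isOpen.frontier_eq]; exact ⟨hp, hpΩ⟩
    obtain ⟨r, hr, T, h, K, -, hK, hpr, hin, hcl, -⟩ := hΩ.exists_chart hpf
    have hK0 : (0 : ℝ) ≤ K := K.2
    refine ⟨r / 2, by positivity, 1 / (K + 2), by positivity, r / 4, by positivity, upDir T,
      (norm_upDir T).le, ?_, hasInnerCone_of_chart hr hK hpr hin hcl⟩
    rw [div_le_one (by positivity)]; linarith

/-- The graph of `h` over the plane of the first two axes, in the original coordinates. -/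
def graphMap (T : R3 ≃ₗᵢ[ℝ] R3) (h : EuclideanSpace ℝ (Fin 2) → ℝ)
    (y : EuclideanSpace ℝ (Fin 2)) : R3 := T.symm !₂[y 0, y 1, h y]

lemma graphMap_planeProj {T : R3 ≃ₗᵢ[ℝ] R3} {h : EuclideanSpace ℝ (Fin 2) → ℝ} {x : R3}
    (hx : h (planeProj T x) = T x 2) : graphMap T h (planeProj T x) = x := by
  rw [graphMap, LinearIsometryEquiv.symm_apply_eq]
  ext i; fin_cases i <;> simp [planeProj] 
  simpa [planeProj] using hx

lemma lipschitzOnWith_graphMap {T : R3 ≃ₗᵢ[ℝ] R3} {h : EuclideanSpace ℝ (Fin 2) → ℝ} {K : NNReal}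
    {D : Set (EuclideanSpace ℝ (Fin 2))} (hK : LipschitzOnWith K h D) :
    LipschitzOnWith (1 + K) (graphMap T h) D := by
  refine LipschitzOnWith.of_dist_le_mul fun x hx y hy => ?_
  have h1 := hK.dist_le_mul x hx y hy
  rw [Real.dist_eq, dist_eq_norm] at h1
  rw [graphMap, graphMap, T.symm.dist_map, dist_eq_norm, dist_eq_norm]
  refine abs_le_of_sq_le_sq' ?_ (by positivity) |>.2
  have h2 : ‖x - y‖ ^ 2 = (x 0 - y 0) ^ 2 + (x 1 - y 1) ^ 2 := by
    rw [EuclideanSpace.norm_sq_eq]; simp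
  rw [EuclideanSpace.norm_sq_eq]
  simp only [Fin.sum_univ_three, Real.norm_eq_abs, sq_abs]
  simp
  have h3 : (h x - h y) ^ 2 ≤ (K * ‖x - y‖) ^ 2 :=
    sq_le_sq' (by linarith [(abs_le.1 h1).1]) (abs_le.1 h1).2
  have : (0 : ℝ) ≤ K := K.2
  nlinarith [sq_nonneg ‖x - y‖, mul_nonneg this (sq_nonneg ‖x - y‖)]

lemma continuous_graphMap (T : R3 ≃ₗᵢ[ℝ] R3) {h : EuclideanSpace ℝ (Fin 2) → ℝ}
    (hh : Continuous h) : Continuous (graphMap T h) := by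
  unfold graphMap
  refine T.symm.continuous.comp ?_
  refine (PiLp.continuous_toLp 2 _).comp ?_
  refine continuous_pi fun i => ?_
  fin_cases i <;> simp <;> fun_prop

/-- Near a chart, the surface measure is bounded by a multiple of the push-forward of the
two-dimensional Lebesgue measure: the graph map is Lipschitz. -/
lemma surfaceMeasure_restrict_le {Ω : Set R3} {T : R3 ≃ₗᵢ[ℝ] R3}
    {h : EuclideanSpace ℝ (Fin 2) → ℝ} {K : NNReal} {D : Set (EuclideanSpace ℝ (Fin 2))}
    (hh : Continuous h) (hK : LipschitzOnWith K h D) {B : Set R3}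
    (hB : MeasurableSet B) (hB2 : ∀ x ∈ frontier Ω ∩ B, planeProj T x ∈ D ∧
      h (planeProj T x) = T x 2) :
    (surfaceMeasure Ω).restrict B ≤
      ((1 + K : NNReal) ^ 2 : ENNReal) • (volume.restrict D).map (graphMap T h) := by
  refine Measure.le_iff.2 fun E hE => ?_
  have hG := (continuous_graphMap T hh).measurable
  rw [Measure.restrict_apply hE, surfaceMeasure, Measure.restrict_apply (hE.inter hB),
    Measure.smul_apply, Measure.map_apply hG hE, Measure.restrict_apply (hG hE)]
  have hsub : E ∩ B ∩ frontier Ω ⊆ graphMap T h '' (graphMap T h ⁻¹' E ∩ D) := by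
    rintro x ⟨⟨hxE, hxB⟩, hxf⟩
    obtain ⟨h1, h2⟩ := hB2 x ⟨hxf, hxB⟩
    exact ⟨planeProj T x, ⟨by simpa [graphMap_planeProj h2] using hxE, h1⟩, graphMap_planeProj h2⟩
  refine (measure_mono hsub).trans ?_
  have h1 := ((lipschitzOnWith_graphMap (T := T) hK).mono
    (Set.inter_subset_right (s := graphMap T h ⁻¹' E))).hausdorffMeasure_image_le
      (d := 2) (by norm_num)
  rw [← EuclideanSpace.euclideanHausdorffMeasure_eq_volume 2,
    Measure.euclideanHausdorffMeasure_def, Measure.euclideanHausdorffMeasure_def,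
    Measure.smul_apply, Measure.smul_apply, smul_eq_mul, mul_smul_comm]
  have h2 : ((1 + K : NNReal) : ENNReal) ^ (2 : ℝ) = ((1 + K : NNReal) : ENNReal) ^ 2 := by
    rw [← ENNReal.rpow_natCast]; norm_num
  rw [h2] at h1
  rw [ENNReal.smul_def, ENNReal.smul_def]
  gcongr
  exact_mod_cast h1

/-- The coordinates of a chart, as a measure preserving map `ℝ² × ℝ → ℝ³`. -/
lemma measurePreserving_graphCoords (T : R3 ≃ₗᵢ[ℝ] R3) :
    MeasurePreserving
      (fun q : EuclideanSpace ℝ (Fin 2) × ℝ => T.symm !₂[q.1 0, q.1 1, q.2]) := by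
  have h1 : MeasurePreserving (fun q : EuclideanSpace ℝ (Fin 2) × ℝ => (q.2, q.1.ofLp))
      volume volume :=
    ((MeasurePreserving.id volume).prod (PiLp.volume_preserving_ofLp (Fin 2))).comp
      Measure.measurePreserving_swap
  have h2 := (volume_preserving_piFinSuccAbove (fun _ : Fin 3 => ℝ) 2).symm
  have h3 := ((T.symm.measurePreserving.comp (PiLp.volume_preserving_toLp (Fin 3))).comp h2).comp h1
  have h4 : (fun q : EuclideanSpace ℝ (Fin 2) × ℝ => T.symm !₂[q.1 0, q.1 1, q.2]) =
      ((⇑T.symm ∘ WithLp.toLp 2) ∘ ⇑(MeasurableEquiv.piFinSuccAbove (fun _ : Fin 3 => ℝ) 2).symm) ∘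
        fun q => (q.2, q.1.ofLp) := by
    funext q
    simp only [Function.comp_apply]
    congr 2
    ext i
    fin_cases i <;> rfl
  rw [h4]
  exact h3

/-- Fubini's theorem in a chart, for the region above (and below) the graph. -/
lemma lintegral_graphMap_add {T : R3 ≃ₗᵢ[ℝ] R3} {h : EuclideanSpace ℝ (Fin 2) → ℝ}
    {F : R3 → ENNReal} (hF : Measurable F) :
    ∫⁻ y, ∫⁻ t : ℝ, F (graphMap T h y + t • upDir T) = ∫⁻ x, F x := by
  have hmp := measurePreserving_graphCoords T
  rw [← hmp.lintegral_comp hF, Measure.volume_eq_prod,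
    lintegral_prod (fun q : EuclideanSpace ℝ (Fin 2) × ℝ => F (T.symm !₂[q.1 0, q.1 1, q.2]))
      (hF.comp hmp.measurable).aemeasurable]
  refine lintegral_congr fun y => ?_
  rw [← lintegral_add_left_eq_self (fun t => F (T.symm !₂[y 0, y 1, t])) (h y)]
  refine lintegral_congr fun t => ?_
  congr 1
  rw [graphMap, upDir, ← map_smul, ← map_add]
  congr 1
  ext i; fin_cases i <;> simp

/-- Integration over the boundary and along the transversal segments of a cone field is dominated
by integration over the domain. -/
lemma IsSmoothBoundedDomain.exists_boundary_chart {Ω : Set R3} (hΩ : IsSmoothBoundedDomain Ω)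
    {p : R3} (hp : p ∈ frontier Ω) : ∃ r > 0, ∃ s > 0, ∃ e : R3, ∃ C : NNReal, ‖e‖ ≤ 1 ∧
      (∀ x ∈ frontier Ω ∩ Metric.ball p r, ∀ t ∈ Set.Ioc (0 : ℝ) s, x + t • e ∈ Ω) ∧
      ∀ F : R3 → ENNReal, Measurable F →
        ∫⁻ x in Metric.ball p r, (∫⁻ t in Set.Ioc (0 : ℝ) s, F (x + t • e)) ∂(surfaceMeasure Ω) ≤
          C * ∫⁻ x in Ω, F x := by
  obtain ⟨r, hr, T, h, K, hh, hK, hpr, hin, hcl, hfr⟩ := hΩ.exists_chart hp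
  have hcone := hasInnerCone_of_chart hr hK hpr hin hcl
  have hseg : ∀ x ∈ frontier Ω ∩ Metric.ball p (r / 2), ∀ t ∈ Set.Ioc 0 (r / 4),
      x + t • upDir T ∈ Ω := fun x hx t ht =>
    hcone x ⟨frontier_subset_closure hx.1, hx.2⟩ t ht
      (Metric.mem_closedBall_self (by have := ht.1; positivity))
  refine ⟨r / 2, by positivity, r / 4, by positivity, upDir T, (1 + K) ^ 2, (norm_upDir T).le,
    hseg, fun F hF => ?_⟩
  have hle : Metric.ball p (r / 2) ⊆ Metric.ball p r := Metric.ball_subset_ball (by linarith)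
  have hΩm := hΩ.isOpen.measurableSet
  set F' := Ω.indicator F with hF'
  have hF'm : Measurable F' := hF.indicator hΩm
  set H : R3 → ENNReal := fun x => ∫⁻ t in Set.Ioc 0 (r / 4), F' (x + t • upDir T) with hH
  have hHm : Measurable H := by
    have : Measurable fun q : R3 × ℝ => F' (q.1 + q.2 • upDir T) :=
      hF'm.comp (by fun_prop)
    exact this.lintegral_prod_right'
  calc _ ≤ ∫⁻ x in Metric.ball p (r / 2), H x ∂(surfaceMeasure Ω) := by
        have hfrm : ∀ᵐ x ∂(surfaceMeasure Ω), x ∈ frontier Ω :=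
          ae_restrict_mem isClosed_frontier.measurableSet
        refine lintegral_mono_ae ?_
        filter_upwards [ae_restrict_of_ae hfrm, ae_restrict_mem Metric.isOpen_ball.measurableSet]
          with x hx1 hx2
        refine setLIntegral_mono' measurableSet_Ioc fun t ht => ?_
        simp [hF', hseg x ⟨hx1, hx2⟩ t ht]
    _ ≤ ∫⁻ x, H x ∂(((1 + K : NNReal) ^ 2 : ENNReal) •
          (volume.restrict (Metric.ball (planeProj T p) r)).map (graphMap T h)) := by
        refine lintegral_mono' ?_ le_rfl
        exact surfaceMeasure_restrict_le hh hK
          Metric.isOpen_ball.measurableSet fun x hx => ⟨hpr x (hle hx.2), hfr x ⟨hx.1, hle hx.2⟩⟩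
    _ = (1 + K : NNReal) ^ 2 * ∫⁻ y in Metric.ball (planeProj T p) r, H (graphMap T h y) := by
        rw [lintegral_smul_measure, lintegral_map hHm (continuous_graphMap T hh).measurable,
          smul_eq_mul]
    _ ≤ (1 + K : NNReal) ^ 2 * ∫⁻ y, ∫⁻ t : ℝ, F' (graphMap T h y + t • upDir T) := by
        gcongr
        · exact Measure.restrict_le_self
        · exact setLIntegral_le_lintegral _ _
    _ = _ := by
        rw [lintegral_graphMap_add hF'm, hF', lintegral_indicator hΩm]
        push_cast
        rfl

/-! ### Means with respect to bump functions -/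

/-- The probability measure on `ℝ³` whose density is a normalized bump function. -/
def bumpMeasure {c : R3} (b : ContDiffBump c) : Measure R3 :=
  volume.withDensity fun y => ENNReal.ofReal (b.normed volume y)

lemma measurable_ofReal_normed {c : R3} (b : ContDiffBump c) :
    Measurable fun y => ENNReal.ofReal (b.normed volume y) :=
  (b.continuous_normed (μ := volume)).measurable.ennreal_ofReal

instance {c : R3} (b : ContDiffBump c) : IsProbabilityMeasure (bumpMeasure b) := by
  constructor
  rw [bumpMeasure, withDensity_apply _ MeasurableSet.univ, Measure.restrict_univ,
    ← ofReal_integral_eq_lintegral_ofReal b.integrable_normed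
      (Filter.Eventually.of_forall b.nonneg_normed), b.integral_normed, ENNReal.ofReal_one]

lemma ae_mem_ball_bumpMeasure {c : R3} (b : ContDiffBump c) :
    ∀ᵐ y ∂(bumpMeasure b), y ∈ Metric.ball c b.rOut := by
  rw [bumpMeasure, ae_withDensity_iff (measurable_ofReal_normed b)]
  refine Filter.Eventually.of_forall fun y hy => ?_
  rw [← b.support_normed_eq (μ := volume)]
  intro h0
  exact hy (by simp [h0])

lemma integral_bumpMeasure {E : Type*} [NormedAddCommGroup E] [NormedSpace ℝ E] {c : R3}
    (b : ContDiffBump c) (F : R3 → E) :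
    ∫ y, F y ∂(bumpMeasure b) = ∫ y, b.normed volume y • F y := by
  rw [bumpMeasure, integral_withDensity_eq_integral_toReal_smul (measurable_ofReal_normed b)
    (by simp)]
  simp [ENNReal.toReal_ofReal (b.nonneg_normed _)]

/-- The weighted mean `∫ b(y) G(x + y) dy` of `G`, with the normalized bump function `b` as
weight. -/
def bumpAverage {E : Type*} [NormedAddCommGroup E] [NormedSpace ℝ E] {c : R3}
    (b : ContDiffBump c) (G : R3 → E) (x : R3) : E := ∫ y, G (x + y) ∂(bumpMeasure b)

section
variable {E : Type*} [NormedAddCommGroup E] [NormedSpace ℝ E] {c : R3} (b : ContDiffBump c)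

lemma bumpAverage_eq (G : R3 → E) (x : R3) :
    bumpAverage b G x = ∫ z, b.normed volume (z - x) • G z := by
  rw [bumpAverage, integral_bumpMeasure]
  rw [← integral_add_right_eq_self (fun z => b.normed volume (z - x) • G z) x]
  simp [add_comm]

lemma integrable_bumpMeasure_translate {G : R3 → E} (hG : LocallyIntegrable G volume) (x : R3) :
    Integrable (fun y => G (x + y)) (bumpMeasure b) := by
  rw [bumpMeasure, integrable_withDensity_iff_integrable_smul' (measurable_ofReal_normed b)
    (by simp)]
  have h1 : Integrable fun z => b.normed volume (z - x) • G z := by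
    refine hG.integrable_smul_left_of_hasCompactSupport
      ((b.continuous_normed (μ := volume)).comp (by fun_prop)) ?_
    exact b.hasCompactSupport_normed.comp_homeomorph (Homeomorph.subRight x)
  have h2 := (measurePreserving_add_left volume x).integrable_comp_of_integrable h1
  refine h2.congr (Filter.Eventually.of_forall fun y => ?_)
  simp [ENNReal.toReal_ofReal (b.nonneg_normed _)]

lemma bumpAverage_sub [CompleteSpace E] {G : R3 → E} (hG : LocallyIntegrable G volume) (x : R3) :
    ∫ y, (G (x + y) - G x) ∂(bumpMeasure b) = bumpAverage b G x - G x := by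
  rw [integral_sub (integrable_bumpMeasure_translate b hG x) (integrable_const _)]
  simp [bumpAverage]

lemma lintegral_bumpAverage_sub_le [CompleteSpace E] {G : R3 → E} (hG : StronglyMeasurable G)
    (hGl : LocallyIntegrable G volume) {A : Set R3} {ε : ENNReal}
    (h : ∀ y ∈ Metric.ball c b.rOut, ∫⁻ x in A, ‖G (x + y) - G x‖ₑ ^ 2 ≤ ε) :
    ∫⁻ x in A, ‖bumpAverage b G x - G x‖ₑ ^ 2 ≤ ε := by
  simp_rw [← bumpAverage_sub b hGl]
  exact lintegral_average_sub_le _ hG ((ae_mem_ball_bumpMeasure b).mono h)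

/-- The mean is the convolution with the reflected bump function. -/
lemma bumpAverage_eq_convolution (g : R3 → ℝ) :
    bumpAverage b g = convolution (fun y => b.normed volume (-y)) g
      (ContinuousLinearMap.mul ℝ ℝ) volume := by
  funext x
  rw [bumpAverage_eq, convolution_def, ← integral_sub_left_eq_self _ _ x]
  refine integral_congr_ae (Filter.Eventually.of_forall fun y => ?_)
  simp

lemma hasCompactSupport_normed_neg :
    HasCompactSupport (fun y => b.normed volume (-y)) :=
  b.hasCompactSupport_normed.comp_homeomorph (Homeomorph.neg R3)

lemma contDiff_normed_neg : ContDiff ℝ ∞ (fun y => b.normed volume (-y)) :=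
  (b.contDiff_normed (μ := volume)).comp contDiff_neg

lemma contDiff_bumpAverage {g : R3 → ℝ} (hg : LocallyIntegrable g volume) :
    ContDiff ℝ ∞ (bumpAverage b g) := by
  rw [bumpAverage_eq_convolution]
  exact (hasCompactSupport_normed_neg b).contDiff_convolution_left _ (contDiff_normed_neg b) hg

/-- The derivative of the mean falls on the bump function; the sign is that of `∂ₓ b(z - x)`. -/
lemma fderiv_bumpAverage_apply {g : R3 → ℝ} (hg : LocallyIntegrable g volume) (x v : R3) :
    fderiv ℝ (bumpAverage b g) x v = - ∫ z, g z * fderiv ℝ (b.normed volume) (z - x) v := by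
  have h1 := (hasCompactSupport_normed_neg b).hasFDerivAt_convolution_left
    (ContinuousLinearMap.mul ℝ ℝ) ((contDiff_normed_neg b).of_le (by simp)) hg x
  rw [← bumpAverage_eq_convolution] at h1
  have h2 := ((hasCompactSupport_normed_neg b).fderiv ℝ).convolutionExists_left
    ((ContinuousLinearMap.mul ℝ ℝ).precompL R3)
    ((contDiff_normed_neg b).continuous_fderiv (by simp)) hg x
  rw [h1.fderiv, convolution_def, ContinuousLinearMap.integral_apply h2,
    ← integral_sub_left_eq_self _ _ x, ← integral_neg]
  refine integral_congr_ae (Filter.Eventually.of_forall fun z => ?_)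
  have h3 : fderiv ℝ (fun y => b.normed volume (-y)) (x - z) =
      - fderiv ℝ (b.normed volume) (z - x) := by
    have h4 := ((b.contDiff_normed (μ := volume) (n := 1)).differentiable (by simp)
      (-(x - z))).hasFDerivAt.comp (x - z) (hasFDerivAt_id (x - z)).neg
    rw [show (fun y => b.normed volume (-y)) = b.normed volume ∘ Neg.neg from rfl, h4.fderiv,
      neg_sub]
    ext w
    simp
  simp only [ContinuousLinearMap.precompL_apply, ContinuousLinearMap.mul_apply', sub_sub_cancel,
    h3]
  simp [mul_comm]

end

/-! ### The space `H¹(Ω)` -/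

/-- The element of `H¹(Ω)` with given function and weak gradient. -/
def mkH1 {Ω : Set R3} (u : L2 Ω) (G : L2Vec Ω) (h : IsWeakGradient Ω u G) : H1 Ω :=
  ⟨WithLp.toLp 2 (u, G), h⟩

lemma norm_sq_H1 {Ω : Set R3} (u : H1 Ω) : ‖u‖ ^ 2 = ‖fn u‖ ^ 2 + ‖grad u‖ ^ 2 :=
  WithLp.prod_norm_sq_eq_of_L2 _

lemma norm_fn_le {Ω : Set R3} (u : H1 Ω) : ‖fn u‖ ≤ ‖u‖ := by
  nlinarith [norm_sq_H1 u, norm_nonneg u, norm_nonneg (fn u), sq_nonneg ‖grad u‖]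

lemma norm_grad_le {Ω : Set R3} (u : H1 Ω) : ‖grad u‖ ≤ ‖u‖ := by
  nlinarith [norm_sq_H1 u, norm_nonneg u, norm_nonneg (grad u), sq_nonneg ‖fn u‖]

/-- `u ↦ u`, from `H¹(Ω)` to `L²(Ω)`. -/
def fnL (Ω : Set R3) : H1 Ω →L[ℝ] L2 Ω :=
  LinearMap.mkContinuous ⟨⟨fn, fun _ _ => rfl⟩, fun _ _ => rfl⟩ 1
    fun u => (norm_fn_le u).trans_eq (one_mul _).symm

/-- `u ↦ ∇u`, from `H¹(Ω)` to `L²(Ω; ℝ³)`. -/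
def gradL (Ω : Set R3) : H1 Ω →L[ℝ] L2Vec Ω :=
  LinearMap.mkContinuous ⟨⟨grad, fun _ _ => rfl⟩, fun _ _ => rfl⟩ 1
    fun u => (norm_grad_le u).trans_eq (one_mul _).symm

@[simp] lemma fnL_apply {Ω : Set R3} (u : H1 Ω) : fnL Ω u = fn u := rfl

lemma exists_bound_of_isBounded {Ω : Set R3} (hb : Bornology.IsBounded Ω) {E : Type*}
    [NormedAddCommGroup E] {ψ : R3 → E} (hψ : Continuous ψ) :
    ∃ C, 0 ≤ C ∧ ∀ x ∈ closure Ω, ‖ψ x‖ ≤ C := by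
  obtain ⟨C, hC⟩ := (hb.isCompact_closure).exists_bound_of_continuousOn hψ.continuousOn
  exact ⟨max C 0, le_max_right _ _, fun x hx => (hC x hx).trans (le_max_left _ _)⟩

lemma isFiniteMeasure_restrict {Ω : Set R3} (hb : Bornology.IsBounded Ω) :
    IsFiniteMeasure (volume.restrict Ω) := ⟨by simpa using hb.measure_lt_top⟩

lemma memLp_of_continuous {Ω : Set R3} (ho : IsOpen Ω) (hb : Bornology.IsBounded Ω) {E : Type*}
    [NormedAddCommGroup E] [SecondCountableTopology E] {ψ : R3 → E} (hψ : Continuous ψ) :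
    MemLp ψ 2 (volume.restrict Ω) := by
  obtain ⟨C, -, hC⟩ := exists_bound_of_isBounded hb hψ
  have := isFiniteMeasure_restrict hb
  refine MemLp.of_bound hψ.aestronglyMeasurable C ?_
  filter_upwards [ae_restrict_mem ho.measurableSet] with x hx using hC x (subset_closure hx)

lemma inner_gradient {φ : R3 → ℝ} (x v : R3) : ⟪gradient φ x, v⟫ = fderiv ℝ φ x v :=
  InnerProductSpace.toDual_symm_apply

lemma enorm_gradient {φ : R3 → ℝ} (x : R3) : ‖gradient φ x‖ₑ = ‖fderiv ℝ φ x‖ₑ := by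
  rw [← toDual_gradient, ← ofReal_norm, ← ofReal_norm, LinearIsometryEquiv.norm_map]

lemma continuous_gradient {φ : R3 → ℝ} (hφ : ContDiff ℝ 1 φ) : Continuous (gradient φ) :=
  (InnerProductSpace.toDual ℝ R3).symm.continuous.comp (hφ.continuous_fderiv (by simp))

lemma setIntegral_eq_integral_of_tsupport {Ω : Set R3} {F ψ : R3 → ℝ}
    (hs : tsupport ψ ⊆ Ω) (hF : ∀ x, ψ x = 0 → F x = 0) : ∫ x in Ω, F x = ∫ x, F x :=
  setIntegral_eq_integral_of_forall_compl_eq_zero fun x hx =>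
    hF x (image_eq_zero_of_notMem_tsupport fun h => hx (hs h))

/-- The restriction to `Ω` of a function of class `C¹` belongs to `H¹(Ω)`. -/
lemma exists_H1_of_contDiff {Ω : Set R3} (ho : IsOpen Ω) (hb : Bornology.IsBounded Ω)
    {φ : R3 → ℝ} (hφ : ContDiff ℝ 1 φ) : ∃ u : H1 Ω,
      fn u =ᵐ[volume.restrict Ω] φ ∧ grad u =ᵐ[volume.restrict Ω] gradient φ := by
  have m1 := memLp_of_continuous ho hb hφ.continuous
  have m2 := memLp_of_continuous ho hb (continuous_gradient hφ)
  refine ⟨mkH1 (m1.toLp φ) (m2.toLp _) fun ψ h1 h2 h3 v => ?_, m1.coeFn_toLp, m2.coeFn_toLp⟩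
  have e1 : ∫ x in Ω, (m1.toLp φ) x * fderiv ℝ ψ x v = ∫ x, φ x * fderiv ℝ ψ x v := by
    rw [← setIntegral_eq_integral_of_tsupport (Ω := Ω) (ψ := fun x => fderiv ℝ ψ x v)
      ((tsupport_fderiv_apply_subset ℝ v).trans h3) (by intro x hx; simp [hx])]
    refine integral_congr_ae ?_
    filter_upwards [m1.coeFn_toLp] with x hx
    rw [hx]
  have e2 : ∫ x in Ω, ⟪(m2.toLp _ : L2Vec Ω) x, v⟫ * ψ x = ∫ x, fderiv ℝ φ x v * ψ x := by
    rw [← setIntegral_eq_integral_of_tsupport (Ω := Ω) (ψ := ψ) h3 (by intro x hx; simp [hx])]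
    refine integral_congr_ae ?_
    filter_upwards [m2.coeFn_toLp] with x hx
    rw [hx, inner_gradient]
  rw [e1, e2]
  have c1 : Continuous fun x => fderiv ℝ φ x v :=
    (hφ.continuous_fderiv (by simp)).clm_apply continuous_const
  refine integral_mul_fderiv_eq_neg_fderiv_mul_of_integrable ?_ ?_ ?_
    (fun x _ => hφ.differentiable (by simp) x) (fun x _ => h1.differentiable (by simp) x)
  · exact (c1.mul h1.continuous).integrable_of_hasCompactSupport h2.mul_left
  · exact (hφ.continuous.mul (continuous_fderiv_test h1 v)).integrable_of_hasCompactSupport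
      (hasCompactSupport_fderiv_test h2 v).mul_left
  · exact (hφ.continuous.mul h1.continuous).integrable_of_hasCompactSupport h2.mul_left

lemma memLp_smul_of_continuous {Ω : Set R3} (ho : IsOpen Ω) (hb : Bornology.IsBounded Ω)
    {ρ : R3 → ℝ} (hρ : Continuous ρ) {E : Type*} [NormedAddCommGroup E] [NormedSpace ℝ E]
    {u : R3 → E} (hu : MemLp u 2 (volume.restrict Ω)) :
    MemLp (fun x => ρ x • u x) 2 (volume.restrict Ω) := by
  obtain ⟨C, -, hC⟩ := exists_bound_of_isBounded hb hρ
  refine hu.of_le_mul (hρ.aestronglyMeasurable.smul hu.1) (c := C) ?_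
  filter_upwards [ae_restrict_mem ho.measurableSet] with x hx
  rw [norm_smul]
  gcongr
  exact hC x (subset_closure hx)

lemma memLp_smul_vec_of_continuous {Ω : Set R3} (ho : IsOpen Ω) (hb : Bornology.IsBounded Ω)
    {V : R3 → R3} (hV : Continuous V) {u : R3 → ℝ} (hu : MemLp u 2 (volume.restrict Ω)) :
    MemLp (fun x => u x • V x) 2 (volume.restrict Ω) := by
  obtain ⟨C, -, hC⟩ := exists_bound_of_isBounded hb hV
  refine hu.of_le_mul (hu.1.smul hV.aestronglyMeasurable) (c := C) ?_
  filter_upwards [ae_restrict_mem ho.measurableSet] with x hx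
  rw [norm_smul, mul_comm]
  gcongr
  exact hC x (subset_closure hx)

/-- Multiplication by a smooth function, with the product rule for weak gradients. -/
lemma exists_H1_mul {Ω : Set R3} (ho : IsOpen Ω) (hb : Bornology.IsBounded Ω)
    {ρ : R3 → ℝ} (hρ : ContDiff ℝ ∞ ρ) (u : H1 Ω) : ∃ v : H1 Ω,
      fn v =ᵐ[volume.restrict Ω] (fun x => ρ x * fn u x) ∧
      grad v =ᵐ[volume.restrict Ω] fun x => ρ x • grad u x + fn u x • gradient ρ x := by
  have m1 : MemLp (fun x => ρ x * fn u x) 2 (volume.restrict Ω) :=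
    memLp_smul_of_continuous ho hb hρ.continuous (Lp.memLp (fn u))
  have m2 : MemLp (fun x => ρ x • grad u x + fn u x • gradient ρ x) 2 (volume.restrict Ω) :=
    (memLp_smul_of_continuous ho hb hρ.continuous (Lp.memLp (grad u))).add
      (memLp_smul_vec_of_continuous ho hb (continuous_gradient (hρ.of_le (by simp)))
        (Lp.memLp (fn u)))
  refine ⟨mkH1 (m1.toLp _) (m2.toLp _) fun ψ h1 h2 h3 v => ?_, m1.coeFn_toLp, m2.coeFn_toLp⟩
  have t1 : ContDiff ℝ ∞ fun x => ρ x * ψ x := hρ.mul h1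
  have t2 : HasCompactSupport fun x => ρ x * ψ x := h2.mul_left
  have t3 : tsupport (fun x => ρ x * ψ x) ⊆ Ω := (tsupport_mul_subset_right).trans h3
  have key := u.2 _ t1 t2 t3 v
  have i1 := integrable_mul_test (fn u) (continuous_fderiv_test t1 v)
    (hasCompactSupport_fderiv_test t2 v)
  have cρ : Continuous fun x => fderiv ℝ ρ x v * ψ x :=
    (continuous_fderiv_test hρ v).mul h1.continuous
  have sρ : HasCompactSupport fun x => fderiv ℝ ρ x v * ψ x := h2.mul_left
  have i2 := integrable_mul_test (fn u) cρ sρ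
  have i3 := integrable_inner_mul_test (grad u) v t1.continuous t2
  have e1 : ∫ x in Ω, (m1.toLp _ : L2 Ω) x * fderiv ℝ ψ x v =
      ∫ x in Ω, (fn u x * fderiv ℝ (fun x => ρ x * ψ x) x v -
        fn u x * (fderiv ℝ ρ x v * ψ x)) := by
    refine integral_congr_ae ?_
    filter_upwards [m1.coeFn_toLp] with x hx
    rw [hx, fderiv_fun_mul (hρ.differentiable (by simp) x) (h1.differentiable (by simp) x)]
    simp
    ring
  have e2 : ∫ x in Ω, ⟪(m2.toLp _ : L2Vec Ω) x, v⟫ * ψ x =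
      ∫ x in Ω, (⟪grad u x, v⟫ * (ρ x * ψ x) + fn u x * (fderiv ℝ ρ x v * ψ x)) := by
    refine integral_congr_ae ?_
    filter_upwards [m2.coeFn_toLp] with x hx
    rw [hx, inner_add_left, real_inner_smul_left, real_inner_smul_left, inner_gradient]
    ring
  rw [e1, e2, integral_sub i1 i2, integral_add i3 i2]
  have key' : ∫ x in Ω, fn u x * fderiv ℝ (fun x => ρ x * ψ x) x v =
    - ∫ x in Ω, ⟪grad u x, v⟫ * (ρ x * ψ x) := key
  rw [key']
  ring

/-! ### Density of the functions that are `C¹` up to the boundary -/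

lemma memLp_indicator {Ω : Set R3} (ho : IsOpen Ω) {E : Type*} [NormedAddCommGroup E]
    (u : Lp E 2 (volume.restrict Ω)) : MemLp (Ω.indicator u) 2 volume :=
  (memLp_indicator_iff_restrict ho.measurableSet).2 (Lp.memLp u)

lemma locallyIntegrable_indicator {Ω : Set R3} (ho : IsOpen Ω) {E : Type*} [NormedAddCommGroup E]
    (u : Lp E 2 (volume.restrict Ω)) : LocallyIntegrable (Ω.indicator u) volume :=
  (memLp_indicator ho u).locallyIntegrable (by norm_num)

lemma fderiv_normed_sub {c : R3} (b : ContDiffBump c) (x z v : R3) :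
    fderiv ℝ (fun z => b.normed volume (z - x)) z v = fderiv ℝ (b.normed volume) (z - x) v := by
  rw [fderiv_comp_sub]

lemma tsupport_normed_sub {c : R3} (b : ContDiffBump c) (x : R3) :
    tsupport (fun z => b.normed volume (z - x)) = Metric.closedBall (x + c) b.rOut := by
  have h := tsupport_comp_eq_preimage (b.normed volume) (Homeomorph.subRight x)
  have h2 : (fun z => b.normed volume (z - x)) = b.normed volume ∘ (Homeomorph.subRight x) := rfl
  rw [h2, h, b.tsupport_normed_eq]
  ext z
  simp only [Set.mem_preimage, Metric.mem_closedBall, Homeomorph.coe_subRight, dist_eq_norm]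
  rw [show z - x - c = z - (x + c) by abel]

/-- Where the bump function fits into `Ω`, the gradient of the mean is the mean of the weak
gradient. -/
lemma fderiv_bumpAverage_eq_inner {Ω : Set R3} (ho : IsOpen Ω) {c : R3} (b : ContDiffBump c)
    (v : H1 Ω) {x : R3} (hx : Metric.closedBall (x + c) b.rOut ⊆ Ω) (e : R3) :
    fderiv ℝ (bumpAverage b (Ω.indicator (fn v))) x e =
      ⟪bumpAverage b (Ω.indicator (grad v)) x, e⟫ := by
  have hΩm := ho.measurableSet
  set ψ : R3 → ℝ := fun z => b.normed volume (z - x) with hψ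
  have t1 : ContDiff ℝ ∞ ψ :=
    (b.contDiff_normed (μ := volume)).comp (contDiff_id.sub contDiff_const)
  have t2 : HasCompactSupport ψ :=
    b.hasCompactSupport_normed.comp_homeomorph (Homeomorph.subRight x)
  have t3 : tsupport ψ ⊆ Ω := (tsupport_normed_sub b x).le.trans hx
  have key : ∫ z in Ω, fn v z * fderiv ℝ ψ z e = - ∫ z in Ω, ⟪grad v z, e⟫ * ψ z :=
    v.2 ψ t1 t2 t3 e
  rw [fderiv_bumpAverage_apply b (locallyIntegrable_indicator ho _), bumpAverage_eq]
  have hint : Integrable (fun z => b.normed volume (z - x) • Ω.indicator (grad v) z) :=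
    (locallyIntegrable_indicator ho (grad v)).integrable_smul_left_of_hasCompactSupport
      t1.continuous t2
  have e1 : ∫ z, Ω.indicator (fn v) z * fderiv ℝ (b.normed volume) (z - x) e =
      ∫ z in Ω, fn v z * fderiv ℝ ψ z e := by
    rw [← integral_indicator hΩm]
    refine integral_congr_ae (Filter.Eventually.of_forall fun z => ?_)
    by_cases hz : z ∈ Ω <;> simp [hz, hψ, fderiv_normed_sub]
  rw [e1, key, neg_neg, real_inner_comm, ← integral_inner hint, ← integral_indicator hΩm]
  refine integral_congr_ae (Filter.Eventually.of_forall fun z => ?_)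
  by_cases hz : z ∈ Ω
  · simp [hz, hψ, real_inner_smul_right, real_inner_comm, mul_comm]
  · simp [hz]

/-- The subspace of `H¹(Ω)` of the restrictions to `Ω` of the `C¹` functions on `ℝ³`. That the weak
gradient is the classical one is made part of the definition. -/
def restrictC1 (Ω : Set R3) : Submodule ℝ (H1 Ω) where
  carrier := {u | ∃ φ : R3 → ℝ, ContDiff ℝ 1 φ ∧ fn u =ᵐ[volume.restrict Ω] φ ∧
    grad u =ᵐ[volume.restrict Ω] gradient φ}
  zero_mem' := by
    refine ⟨fun _ => 0, contDiff_const, Lp.coeFn_zero _ _ _, ?_⟩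
    have h : gradient (fun _ : R3 => (0 : ℝ)) = 0 := by
      funext x; simp
    rw [h]
    exact Lp.coeFn_zero _ _ _
  add_mem' := by
    rintro u v ⟨φ, hφ, h1, h2⟩ ⟨ψ, hψ, h3, h4⟩
    refine ⟨φ + ψ, hφ.add hψ, (Lp.coeFn_add (fn u) (fn v)).trans (h1.add h3),
      (Lp.coeFn_add (grad u) (grad v)).trans ((h2.add h4).trans ?_)⟩
    refine Filter.Eventually.of_forall fun x => ?_
    simp only [Pi.add_apply, gradient]
    rw [fderiv_add (hφ.differentiable (by simp) x) (hψ.differentiable (by simp) x), map_add]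
  smul_mem' := by
    rintro c u ⟨φ, hφ, h1, h2⟩
    refine ⟨c • φ, hφ.const_smul c, (Lp.coeFn_smul c (fn u)).trans (h1.const_smul c),
      (Lp.coeFn_smul c (grad u)).trans ((h2.const_smul c).trans ?_)⟩
    refine Filter.Eventually.of_forall fun x => ?_
    simp only [Pi.smul_apply, gradient]
    rw [fderiv_const_smul (hφ.differentiable (by simp) x)]
    simp

lemma norm_sq_le_of_lintegral_le {Ω : Set R3} {E : Type*} [NormedAddCommGroup E]
    (u v : Lp E 2 (volume.restrict Ω)) {F G : R3 → E} (hF : u =ᵐ[volume.restrict Ω] F)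
    (hG : v =ᵐ[volume.restrict Ω] G) {ε : ℝ} (hε : 0 ≤ ε)
    (h : ∫⁻ x in Ω, ‖F x - G x‖ₑ ^ 2 ≤ ENNReal.ofReal ε) : ‖u - v‖ ^ 2 ≤ ε := by
  rw [← ENNReal.ofReal_le_ofReal_iff hε, ← lintegral_enorm_sq_Lp]
  refine le_trans (le_of_eq (lintegral_congr_ae ?_)) h
  filter_upwards [Lp.coeFn_sub u v, hF, hG] with x h1 h2 h3
  rw [h1, Pi.sub_apply, h2, h3]

/-- A function in `H¹(Ω)` which vanishes off `S` is a limit of `C¹` functions, if there are bump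
functions concentrated near `0` whose translates by points of `Ω` avoid either the complement of
`Ω` or `S`. -/
lemma mem_closure_restrictC1_of_bumps {Ω : Set R3} (ho : IsOpen Ω) (hb : Bornology.IsBounded Ω)
    (v : H1 Ω) (S : Set R3)
    (hS : ∀ᵐ x ∂(volume.restrict Ω), x ∉ S → fn v x = 0 ∧ grad v x = 0)
    (H : ∀ ρ > 0, ∃ (c : R3) (b : ContDiffBump c), Metric.ball c b.rOut ⊆ Metric.ball 0 ρ ∧
      ∀ x ∈ Ω, Metric.closedBall (x + c) b.rOut ⊆ Ω ∨
        Disjoint (Metric.closedBall (x + c) b.rOut) S) :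
    v ∈ (restrictC1 Ω).topologicalClosure := by
  have hΩm := ho.measurableSet
  rw [← SetLike.mem_coe, Submodule.topologicalClosure_coe, Metric.mem_closure_iff]
  intro ε hε
  have hε' : 0 < ENNReal.ofReal (ε ^ 2 / 4) := by simp; positivity
  obtain ⟨ρ1, hρ1, H1⟩ := exists_lintegral_translate_sub_le (memLp_indicator ho (fn v)) hε'
  obtain ⟨ρ2, hρ2, H2⟩ := exists_lintegral_translate_sub_le (memLp_indicator ho (grad v)) hε'
  obtain ⟨c, b, hcb, hb2⟩ := H (min ρ1 ρ2) (lt_min hρ1 hρ2)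
  have hball : ∀ y ∈ Metric.ball c b.rOut, ‖y‖ < ρ1 ∧ ‖y‖ < ρ2 := fun y hy => by
    simpa using hcb hy
  have li1 := locallyIntegrable_indicator ho (fn v)
  have li2 := locallyIntegrable_indicator ho (grad v)
  have A1 : ∫⁻ x in Ω, ‖bumpAverage b (Ω.indicator (fn v)) x - Ω.indicator (fn v) x‖ₑ ^ 2 ≤
      ENNReal.ofReal (ε ^ 2 / 4) :=
    lintegral_bumpAverage_sub_le b ((Lp.stronglyMeasurable _).indicator hΩm) li1 fun y hy =>
      (setLIntegral_le_lintegral _ _).trans (H1 y (hball y hy).1)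
  have A2 : ∫⁻ x in Ω, ‖bumpAverage b (Ω.indicator (grad v)) x - Ω.indicator (grad v) x‖ₑ ^ 2 ≤
      ENNReal.ofReal (ε ^ 2 / 4) :=
    lintegral_bumpAverage_sub_le b ((Lp.stronglyMeasurable _).indicator hΩm) li2 fun y hy =>
      (setLIntegral_le_lintegral _ _).trans (H2 y (hball y hy).2)
  set w := bumpAverage b (Ω.indicator (fn v)) with hw
  have hwC : ContDiff ℝ ∞ w := contDiff_bumpAverage b li1
  have hgrad : ∀ x ∈ Ω, gradient w x = bumpAverage b (Ω.indicator (grad v)) x := by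
    intro x hx
    refine ext_inner_right ℝ fun e => ?_
    rw [inner_gradient]
    rcases hb2 x hx with h | h
    · exact fderiv_bumpAverage_eq_inner ho b v h e
    · -- Off the support of `v` both sides are integrals of functions that vanish almost everywhere.
      have hS' : ∀ᵐ z ∂(volume : Measure R3), z ∈ Ω → z ∉ S → fn v z = 0 ∧ grad v z = 0 :=
        (ae_restrict_iff' hΩm).1 hS
      have hts : ∀ z ∈ S, z ∉ Metric.closedBall (x + c) b.rOut := fun z hz hz2 =>
        Set.disjoint_left.1 h hz2 hz
      rw [hw, fderiv_bumpAverage_apply b li1, bumpAverage_eq]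
      have z1 : ∫ z, Ω.indicator (fn v) z * fderiv ℝ (b.normed volume) (z - x) e = 0 := by
        refine integral_eq_zero_of_ae ?_
        filter_upwards [hS'] with z hz
        by_cases hzΩ : z ∈ Ω
        · by_cases hzS : z ∈ S
          · have h1 : z ∉ tsupport (fun z => fderiv ℝ (fun z => b.normed volume (z - x)) z e) :=
              fun h2 => hts z hzS ((tsupport_normed_sub b x).le
                (tsupport_fderiv_apply_subset ℝ e h2))
            have h2 := image_eq_zero_of_notMem_tsupport h1
            rw [fderiv_normed_sub] at h2
            simp [h2]
          · simp [hzΩ, (hz hzΩ hzS).1]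
        · simp [hzΩ]
      have z2 : ∫ z, b.normed volume (z - x) • Ω.indicator (grad v) z = 0 := by
        refine integral_eq_zero_of_ae ?_
        filter_upwards [hS'] with z hz
        by_cases hzΩ : z ∈ Ω
        · by_cases hzS : z ∈ S
          · have h1 : z ∉ tsupport (fun z => b.normed volume (z - x)) :=
              fun h2 => hts z hzS ((tsupport_normed_sub b x).le h2)
            have h2 := image_eq_zero_of_notMem_tsupport h1
            simp only at h2
            simp [h2]
          · simp [hzΩ, (hz hzΩ hzS).2]
        · simp [hzΩ]
      rw [z1, z2]; simp
  obtain ⟨U, hU1, hU2⟩ := exists_H1_of_contDiff ho hb (hwC.of_le (by simp))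
  refine ⟨U, ⟨w, hwC.of_le (by simp), hU1, hU2⟩, ?_⟩
  have hind : ∀ {E : Type} [NormedAddCommGroup E] (u : Lp E 2 (volume.restrict Ω)),
      u =ᵐ[volume.restrict Ω] Ω.indicator u := fun u => by
    filter_upwards [ae_restrict_mem hΩm] with x hx
    simp [hx]
  have hU2' : grad U =ᵐ[volume.restrict Ω] bumpAverage b (Ω.indicator (grad v)) := by
    filter_upwards [hU2, ae_restrict_mem hΩm] with x h1 h2
    rw [h1, hgrad x h2]
  have B1 := norm_sq_le_of_lintegral_le (fn U) (fn v) hU1 (hind (fn v)) (by positivity) A1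
  have B2 := norm_sq_le_of_lintegral_le (grad U) (grad v) hU2' (hind (grad v)) (by positivity) A2
  rw [dist_comm, dist_eq_norm]
  have h3 := norm_sq_H1 (U - v)
  have h4 : fn (U - v) = fn U - fn v := rfl
  have h5 : grad (U - v) = grad U - grad v := rfl
  rw [h4, h5] at h3
  refine lt_of_pow_lt_pow_left₀ 2 hε.le ?_
  nlinarith

/-- Functions in `H¹(Ω)` supported near a point of the closure of `Ω` are limits of `C¹`
functions. -/
lemma mem_closure_restrictC1_of_support {Ω : Set R3} (ho : IsOpen Ω) (hb : Bornology.IsBounded Ω)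
    {p e : R3} {r c s : ℝ} (hr : 0 < r) (hc : 0 < c) (hc1 : c ≤ 1) (hs : 0 < s) (he : ‖e‖ ≤ 1)
    (hcone : HasInnerCone Ω p e r c s) (v : H1 Ω)
    (hS : ∀ᵐ x ∂(volume.restrict Ω), x ∉ Metric.ball p (r / 2) → fn v x = 0 ∧ grad v x = 0) :
    v ∈ (restrictC1 Ω).topologicalClosure := by
  refine mem_closure_restrictC1_of_bumps ho hb v _ hS fun ρ hρ => ?_
  obtain ⟨t, ht0, hts, htr, htρ⟩ : ∃ t : ℝ, 0 < t ∧ t ≤ s ∧ t ≤ r / 4 ∧ t ≤ ρ / 2 :=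
    ⟨min s (min (r / 4) (ρ / 2)), by positivity, min_le_left _ _,
      (min_le_right _ _).trans (min_le_left _ _), (min_le_right _ _).trans (min_le_right _ _)⟩
  have hct : c * t ≤ t := by nlinarith
  have hte : ‖t • e‖ ≤ t := by
    rw [norm_smul, Real.norm_of_nonneg ht0.le]; nlinarith
  -- A bump function centred at `t • e` pushes the evaluation points into `Ω` along the cones.
  refine ⟨t • e, ⟨c * t / 2, c * t, by positivity, by
    have : 0 < c * t := by positivity
    linarith⟩, fun y hy => ?_, fun x hx => ?_⟩
  · have hy' : dist y (t • e) < c * t := hy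
    have := dist_triangle y (t • e) 0
    rw [dist_zero_right (t • e)] at this
    rw [Metric.mem_ball]
    linarith
  · by_cases hxp : x ∈ Metric.ball p r
    · exact Or.inl (hcone x ⟨subset_closure hx, hxp⟩ t ⟨ht0, hts⟩)
    · refine Or.inr (Set.disjoint_left.2 fun z hz hzp => hxp ?_)
      have hz' : dist z (x + t • e) ≤ c * t := hz
      rw [Metric.mem_ball] at hzp ⊢
      have h1 : dist (x + t • e) x ≤ t := by simpa [dist_eq_norm] using hte
      have h2 := dist_triangle x z p
      have h3 := dist_triangle x (x + t • e) z
      rw [dist_comm x (x + t • e), dist_comm (x + t • e) z] at h3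
      linarith

/-- The restrictions of `C¹` functions are dense in `H¹(Ω)`. -/
lemma IsSmoothBoundedDomain.topologicalClosure_restrictC1 {Ω : Set R3}
    (hΩ : IsSmoothBoundedDomain Ω) : (restrictC1 Ω).topologicalClosure = ⊤ := by
  have ho := hΩ.isOpen
  have hb := hΩ.isBounded
  -- `P s`: some smooth function equal to `1` on `s` multiplies `H¹(Ω)` into the closure.
  let P : Set R3 → Prop := fun s => ∃ ρ : R3 → ℝ, ContDiff ℝ ∞ ρ ∧ (∀ x ∈ s, ρ x = 1) ∧
    ∀ u v : H1 Ω, fn v =ᵐ[volume.restrict Ω] (fun x => ρ x * fn u x) →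
      grad v =ᵐ[volume.restrict Ω] (fun x => ρ x • grad u x + fn u x • gradient ρ x) →
      v ∈ (restrictC1 Ω).topologicalClosure
  have hP : P (closure Ω) := by
    refine hb.isCompact_closure.induction_on ?_ ?_ ?_ ?_
    · refine ⟨fun _ => 0, contDiff_const, by simp, fun u v h1 h2 => ?_⟩
      have : v = 0 := by
        have e1 : fn v = 0 := by
          refine Lp.ext ?_
          filter_upwards [h1, Lp.coeFn_zero ℝ 2 (volume.restrict Ω)] with x h3 h4
          rw [h3, h4]; simp
        have e2 : grad v = 0 := by
          refine Lp.ext ?_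
          filter_upwards [h2, Lp.coeFn_zero R3 2 (volume.restrict Ω)] with x h3 h4
          rw [h3, h4]; simp
        have := norm_sq_H1 v
        rw [e1, e2] at this
        simpa using this
      rw [this]
      exact Submodule.zero_mem _
    · rintro s t hst ⟨ρ, h1, h2, h3⟩
      exact ⟨ρ, h1, fun x hx => h2 x (hst hx), h3⟩
    · rintro s t ⟨ρ, h1, h2, h3⟩ ⟨σ, h4, h5, h6⟩
      -- `ρ + (1 - ρ) σ` is equal to `1` on `s ∪ t`.
      have hτ : ContDiff ℝ ∞ fun x => (1 - ρ x) * σ x := (contDiff_const.sub h1).mul h4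
      refine ⟨fun x => ρ x + (1 - ρ x) * σ x, h1.add hτ, ?_, fun u v h7 h8 => ?_⟩
      · rintro x (hx | hx)
        · simp [h2 x hx]
        · simp [h5 x hx]
      · obtain ⟨u1, h9, h10⟩ := exists_H1_mul ho hb h1 u
        obtain ⟨u2, h11, h12⟩ := exists_H1_mul ho hb h4 (u - u1)
        have e1 : fn v = fn u1 + fn u2 := by
          refine Lp.ext ?_
          have hsub : fn (u - u1) = fn u - fn u1 := rfl
          rw [hsub] at h11
          filter_upwards [h7, h9, h11, Lp.coeFn_add (fn u1) (fn u2), Lp.coeFn_sub (fn u) (fn u1)]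
            with x k1 k2 k3 k4 k5
          rw [k4, Pi.add_apply, k1, k3, k5, Pi.sub_apply, k2]
          ring
        have e2 : grad v = grad u1 + grad u2 := by
          refine Lp.ext ?_
          have hsub : fn (u - u1) = fn u - fn u1 := rfl
          have hsub2 : grad (u - u1) = grad u - grad u1 := rfl
          rw [hsub, hsub2] at h12
          filter_upwards [h8, h9, h10, h12, Lp.coeFn_add (grad u1) (grad u2),
            Lp.coeFn_sub (fn u) (fn u1), Lp.coeFn_sub (grad u) (grad u1)]
            with x k1 k2 k2' k3 k4 k5 k6
          rw [k4, Pi.add_apply, k1, k3, k5, k6, Pi.sub_apply, Pi.sub_apply, k2, k2']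
          have d1 := h1.differentiable (by simp) x
          have d2 := h4.differentiable (by simp) x
          have hg : gradient (fun x => ρ x + (1 - ρ x) * σ x) x =
              gradient ρ x + (1 - ρ x) • gradient σ x - σ x • gradient ρ x := by
            simp only [gradient]
            rw [fderiv_fun_add d1 (hτ.differentiable (by simp) x),
              fderiv_fun_mul (d1.const_sub 1) d2, fderiv_const_sub]
            simp
            abel
          rw [hg]
          module
        have e3 : v = u1 + u2 := by
          refine Subtype.ext ((WithLp.ofLp_injective 2) (Prod.ext e1 e2))
        rw [e3]
        exact Submodule.add_mem _ (h3 u u1 h9 h10) (h6 (u - u1) u2 h11 h12)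
    · intro p hp
      obtain ⟨r, hr, c, hc, s, hs, e, he, hc1, hcone⟩ := hΩ.exists_cone hp
      let f : ContDiffBump p := ⟨r / 8, r / 4, by positivity, by linarith⟩
      refine ⟨Metric.ball p (r / 8),
        mem_nhdsWithin_of_mem_nhds (Metric.ball_mem_nhds p (by positivity)),
        f, f.contDiff, fun x hx => f.one_of_mem_closedBall (Metric.ball_subset_closedBall hx),
        fun u v h1 h2 => ?_⟩
      refine mem_closure_restrictC1_of_support ho hb hr hc hc1 hs he hcone v ?_
      filter_upwards [h1, h2] with x k1 k2 hx
      have hxt : x ∉ tsupport f := fun h => by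
        rw [f.tsupport_eq] at h
        have : dist x p ≤ r / 4 := h
        rw [Metric.mem_ball] at hx
        linarith
      have z1 : f x = 0 := image_eq_zero_of_notMem_tsupport hxt
      have z2 : gradient f x = 0 := by
        have : fderiv ℝ f x = 0 :=
          image_eq_zero_of_notMem_tsupport fun h => hxt (tsupport_fderiv_subset ℝ h)
        simp [gradient, this]
      rw [k1, k2, z1, z2]; simp
  obtain ⟨ρ, h1, h2, h3⟩ := hP
  refine eq_top_iff.2 fun u _ => h3 u u ?_ ?_
  · filter_upwards [ae_restrict_mem ho.measurableSet] with x hx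
    rw [h2 x (subset_closure hx), one_mul]
  · filter_upwards [ae_restrict_mem ho.measurableSet] with x hx
    have h4 : ρ =ᶠ[nhds x] fun _ => 1 := by
      filter_upwards [ho.mem_nhds hx] with y hy using h2 y (subset_closure hy)
    have h5 : gradient ρ x = 0 := by
      simp [gradient, h4.fderiv_eq]
    rw [h2 x (subset_closure hx), h5]; simp

/-! ### The trace inequality -/

/-- Averaging `|φ(x)|² ≤ 2 |φ(x + te)|² + 2 |φ(x + te) - φ(x)|²` over `t ∈ (0, δ]`. -/
lemma enorm_sq_le_lintegral_segment {φ : R3 → ℝ} (hφ : ContDiff ℝ 1 φ) (x : R3) {e : R3}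
    (he : ‖e‖ ≤ 1) (δ : ℝ) : ENNReal.ofReal δ * ‖φ x‖ₑ ^ 2 ≤
      ∫⁻ t in Set.Ioc (0 : ℝ) δ, (2 * ‖φ (x + t • e)‖ₑ ^ 2 +
        2 * ENNReal.ofReal δ ^ 2 * ‖fderiv ℝ φ (x + t • e)‖ₑ ^ 2) := by
  have hc : Continuous fun s : ℝ => fderiv ℝ φ (x + s • e) :=
    (hφ.continuous_fderiv (by simp)).comp (by fun_prop)
  have hc' : Continuous fun s : ℝ => φ (x + s • e) := hφ.continuous.comp (by fun_prop)
  set J := ∫⁻ s in Set.Ioc (0 : ℝ) δ, ‖fderiv ℝ φ (x + s • e)‖ₑ ^ 2 with hJ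
  have he' : ‖e‖ₑ ≤ 1 := by
    rw [← ofReal_norm]; exact ENNReal.ofReal_le_one.2 he
  have h1 : ∀ t ∈ Set.Ioc (0 : ℝ) δ, ‖φ x‖ₑ ^ 2 ≤
      2 * ‖φ (x + t • e)‖ₑ ^ 2 + 2 * (ENNReal.ofReal δ * J) := by
    rintro t ⟨ht0, ht⟩
    calc ‖φ x‖ₑ ^ 2 = ‖φ (x + t • e) + -(φ (x + t • e) - φ x)‖ₑ ^ 2 := by congr 2; ring
      _ ≤ 2 * ‖φ (x + t • e)‖ₑ ^ 2 + 2 * ‖φ (x + t • e) - φ x‖ₑ ^ 2 := by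
        rw [← enorm_neg (φ (x + t • e) - φ x)]
        exact enorm_add_sq_le _ _
      _ ≤ _ := by
        gcongr
        refine (enorm_sub_sq_le_segment hφ x e ht0.le).trans ?_
        calc _ ≤ ENNReal.ofReal δ * 1 ^ 2 * J := by
              gcongr
              exact lintegral_mono_set (Set.Ioc_subset_Ioc_right ht)
          _ = _ := by simp
  have h2 := setLIntegral_mono' (μ := volume) measurableSet_Ioc h1
  rw [setLIntegral_const, Real.volume_Ioc, sub_zero, mul_comm] at h2
  refine h2.trans (le_of_eq ?_)
  have hm : Measurable fun t : ℝ => 2 * ‖φ (x + t • e)‖ₑ ^ 2 :=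
    (hc'.measurable.enorm.pow_const 2).const_mul 2
  rw [lintegral_add_left hm, lintegral_add_left hm, setLIntegral_const,
    Real.volume_Ioc, sub_zero,
    lintegral_const_mul _ (f := fun t => ‖fderiv ℝ φ (x + t • e)‖ₑ ^ 2) (by fun_prop), ← hJ]
  ring

/-- The trace inequality for `C¹` functions, with a small constant in front of the gradient. -/
lemma IsSmoothBoundedDomain.exists_trace_inequality {Ω : Set R3} (hΩ : IsSmoothBoundedDomain Ω) :
    ∃ C : NNReal, ∃ s > 0, ∀ δ ∈ Set.Ioc 0 s, ∀ φ : R3 → ℝ, ContDiff ℝ 1 φ →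
      ENNReal.ofReal δ * ∫⁻ x, ‖φ x‖ₑ ^ 2 ∂(surfaceMeasure Ω) ≤
        C * ∫⁻ x in Ω, (2 * ‖φ x‖ₑ ^ 2 + 2 * ENNReal.ofReal δ ^ 2 * ‖fderiv ℝ φ x‖ₑ ^ 2) := by
  let P : Set R3 → Prop := fun A => ∃ C : NNReal, ∃ s > 0, ∀ δ ∈ Set.Ioc 0 s, ∀ φ : R3 → ℝ,
    ContDiff ℝ 1 φ → ENNReal.ofReal δ * ∫⁻ x in A, ‖φ x‖ₑ ^ 2 ∂(surfaceMeasure Ω) ≤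
        C * ∫⁻ x in Ω, (2 * ‖φ x‖ₑ ^ 2 + 2 * ENNReal.ofReal δ ^ 2 * ‖fderiv ℝ φ x‖ₑ ^ 2)
  have hcpt : IsCompact (frontier Ω) :=
    hΩ.isBounded.isCompact_closure.of_isClosed_subset isClosed_frontier frontier_subset_closure
  have hP : P (frontier Ω) := by
    refine hcpt.induction_on ?_ ?_ ?_ ?_
    · exact ⟨0, 1, one_pos, fun δ _ φ _ => by simp⟩
    · rintro A B hAB ⟨C, s, hs, h⟩
      refine ⟨C, s, hs, fun δ hδ φ hφ => le_trans ?_ (h δ hδ φ hφ)⟩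
      gcongr
    · rintro A B ⟨C, s, hs, h⟩ ⟨C', s', hs', h'⟩
      refine ⟨C + C', min s s', lt_min hs hs', fun δ hδ φ hφ => ?_⟩
      have h1 := h δ ⟨hδ.1, hδ.2.trans (min_le_left _ _)⟩ φ hφ
      have h2 := h' δ ⟨hδ.1, hδ.2.trans (min_le_right _ _)⟩ φ hφ
      calc _ ≤ ENNReal.ofReal δ * ∫⁻ x in A, ‖φ x‖ₑ ^ 2 ∂(surfaceMeasure Ω) +
            ENNReal.ofReal δ * ∫⁻ x in B, ‖φ x‖ₑ ^ 2 ∂(surfaceMeasure Ω) := by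
            rw [← mul_add]
            gcongr
            exact lintegral_union_le _ _ _
        _ ≤ _ := by
            push_cast
            rw [add_mul]
            exact add_le_add h1 h2
    · intro p hp
      obtain ⟨r, hr, s, hs, e, C, he, -, H⟩ := hΩ.exists_boundary_chart hp
      refine ⟨Metric.ball p r, mem_nhdsWithin_of_mem_nhds (Metric.ball_mem_nhds p hr),
        C, s, hs, fun δ hδ φ hφ => ?_⟩
      have hc := hφ.continuous_fderiv (by simp)
      have hc' := hφ.continuous
      refine le_trans ?_ (H (fun x => 2 * ‖φ x‖ₑ ^ 2 +
        2 * ENNReal.ofReal δ ^ 2 * ‖fderiv ℝ φ x‖ₑ ^ 2) (by fun_prop))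
      rw [← lintegral_const_mul _ (by fun_prop)]
      refine lintegral_mono fun x => (enorm_sq_le_lintegral_segment hφ x he δ).trans ?_
      exact lintegral_mono_set (Set.Ioc_subset_Ioc_right hδ.2)
  obtain ⟨C, s, hs, h⟩ := hP
  refine ⟨C, s, hs, fun δ hδ φ hφ => ?_⟩
  have h1 := h δ hδ φ hφ
  rwa [surfaceMeasure, Measure.restrict_restrict isClosed_frontier.measurableSet,
    Set.inter_self] at h1

/-- The trace inequality for the constant function `1` shows that `Γ` has finite area. -/
lemma IsSmoothBoundedDomain.isFiniteMeasure_surfaceMeasure {Ω : Set R3}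
    (hΩ : IsSmoothBoundedDomain Ω) : IsFiniteMeasure (surfaceMeasure Ω) := by
  obtain ⟨C, s, hs, h⟩ := hΩ.exists_trace_inequality
  have h1 := h s ⟨hs, le_rfl⟩ (fun _ => 1) contDiff_const
  have h2 : volume Ω < ⊤ := hΩ.isBounded.measure_lt_top
  constructor
  by_contra htop
  rw [not_lt, top_le_iff] at htop
  simp only [fderiv_fun_const, Pi.zero_apply, enorm_one, one_pow, lintegral_const,
    Measure.restrict_apply_univ, htop] at h1
  rw [one_mul, ENNReal.mul_top (by simpa using hs)] at h1
  refine absurd h1 (not_le.2 ?_)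
  exact ENNReal.mul_lt_top (by simp) (ENNReal.mul_lt_top (by finiteness) h2)

lemma trace_spec (Ω : Set R3) : IsTraceOperator Ω (trace Ω) ∨ trace Ω = 0 := by
  by_cases h : ∃ γ, IsTraceOperator Ω γ
  · left; rw [trace, dif_pos h]; exact h.choose_spec
  · right; rw [trace, dif_neg h]

/-- An inequality between continuous functions on `H¹(Ω)` extends from the dense subspace of `C¹`
functions. -/
lemma le_of_forall_mem_restrictC1 {Ω : Set R3} (hΩ : IsSmoothBoundedDomain Ω) {F G : H1 Ω → ℝ}
    (hF : Continuous F) (hG : Continuous G) (h : ∀ u ∈ restrictC1 Ω, F u ≤ G u) (u : H1 Ω) :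
    F u ≤ G u := by
  have hu : u ∈ (restrictC1 Ω).topologicalClosure := by
    rw [hΩ.topologicalClosure_restrictC1]; trivial
  rw [← SetLike.mem_coe, Submodule.topologicalClosure_coe] at hu
  exact closure_minimal (t := {u | F u ≤ G u}) h (isClosed_le hF hG) hu

lemma continuous_fn (Ω : Set R3) : Continuous (fn : H1 Ω → L2 Ω) := (fnL Ω).continuous

lemma lintegral_of_mem_restrictC1 {Ω : Set R3} {u : H1 Ω} {φ : R3 → ℝ}
    (h1 : fn u =ᵐ[volume.restrict Ω] φ) (h2 : grad u =ᵐ[volume.restrict Ω] gradient φ) :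
    ∫⁻ x in Ω, ‖φ x‖ₑ ^ 2 = ENNReal.ofReal (‖fn u‖ ^ 2) ∧
    ∫⁻ x in Ω, ‖fderiv ℝ φ x‖ₑ ^ 2 = ENNReal.ofReal (‖grad u‖ ^ 2) := by
  rw [← lintegral_enorm_sq_Lp, ← lintegral_enorm_sq_Lp]
  refine ⟨lintegral_congr_ae ?_, lintegral_congr_ae ?_⟩
  · filter_upwards [h1] with x hx
    rw [hx]
  · filter_upwards [h2] with x hx
    rw [hx, enorm_gradient]

/-- The trace inequality in `H¹(Ω)`: the trace is small compared with the `H¹` norm, up to the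
`L²` norm. -/
lemma IsSmoothBoundedDomain.norm_trace_sq_le {Ω : Set R3} (hΩ : IsSmoothBoundedDomain Ω)
    {ε : ℝ} (hε : 0 < ε) : ∃ C, 0 ≤ C ∧ ∀ u : H1 Ω,
      ‖trace Ω u‖ ^ 2 ≤ C * ‖fn u‖ ^ 2 + ε * ‖u‖ ^ 2 := by
  rcases trace_spec Ω with htr | h0
  swap
  · refine ⟨0, le_rfl, fun u => ?_⟩
    rw [h0]; simp; positivity
  obtain ⟨C, s, hs, h⟩ := hΩ.exists_trace_inequality
  have hC : (0 : ℝ) ≤ C := C.2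
  have hof : ∀ {A B D : ℝ}, 0 ≤ A → 0 ≤ B → 0 ≤ D → (C : ENNReal) * (2 * ENNReal.ofReal A +
      2 * ENNReal.ofReal B * ENNReal.ofReal D) = ENNReal.ofReal (C * (2 * A + 2 * B * D)) := by
    intro A B D hA hB hD
    rw [ENNReal.ofReal_mul hC, ENNReal.ofReal_add (by positivity) (by positivity),
      ENNReal.ofReal_mul (by positivity), ENNReal.ofReal_mul (by positivity),
      ENNReal.ofReal_mul (by positivity)]
    simp
  set δ : ℝ := min s (ε / (2 * (C + 1))) with hδ
  have hδ0 : 0 < δ := lt_min hs (by positivity)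
  have hδε : 2 * C * δ ≤ ε := by
    have h1 : δ ≤ ε / (2 * (C + 1)) := min_le_right _ _
    rw [le_div_iff₀ (by positivity)] at h1
    nlinarith
  refine ⟨2 * C / δ, by positivity, ?_⟩
  have hc1 := continuous_fn Ω
  refine le_of_forall_mem_restrictC1 hΩ (by fun_prop) (by fun_prop) fun u => ?_
  rintro ⟨φ, hφ, h1, h2⟩
  obtain ⟨k1, k2⟩ := lintegral_of_mem_restrictC1 h1 h2
  have h3 := h δ ⟨hδ0, min_le_left _ _⟩ φ hφ
  have h4 : ∫⁻ x, ‖φ x‖ₑ ^ 2 ∂(surfaceMeasure Ω) = ENNReal.ofReal (‖trace Ω u‖ ^ 2) := by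
    rw [← lintegral_enorm_sq_Lp]
    refine lintegral_congr_ae ?_
    filter_upwards [htr φ hφ u h1] with x hx
    rw [hx]
  have hc := hφ.continuous_fderiv (by simp)
  have hc' := hφ.continuous
  rw [h4, lintegral_add_left (by fun_prop), lintegral_const_mul _ (by fun_prop),
    lintegral_const_mul _ (by fun_prop), k1, k2, ← ENNReal.ofReal_mul hδ0.le,
    ← ENNReal.ofReal_pow hδ0.le, hof (by positivity) (by positivity) (by positivity),
    ENNReal.ofReal_le_ofReal_iff (by positivity)] at h3
  have h5 : ‖grad u‖ ^ 2 ≤ ‖u‖ ^ 2 := by gcongr; exact norm_grad_le u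
  have h6 : δ * ‖trace Ω u‖ ^ 2 ≤ δ * (2 * C / δ * ‖fn u‖ ^ 2 + ε * ‖u‖ ^ 2) := by
    have e1 : δ * (2 * C / δ * ‖fn u‖ ^ 2 + ε * ‖u‖ ^ 2) =
      2 * C * ‖fn u‖ ^ 2 + δ * ε * ‖u‖ ^ 2 := by field_simp
    rw [e1]
    have e2 : δ * (2 * C * δ) * ‖grad u‖ ^ 2 ≤ δ * ε * ‖u‖ ^ 2 := by gcongr
    nlinarith
  exact le_of_mul_le_mul_left h6 hδ0

/-! ### The compactness estimate -/

/-- The translates of a normalized bump function, as elements of `L²(Ω)`, form a relatively compact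
family, so up to `ε` finitely many of them suffice to test functions of `L²(Ω)`. -/
lemma exists_finset_bump_test {Ω : Set R3} (ho : IsOpen Ω) (hb : Bornology.IsBounded Ω) {c : R3}
    (b : ContDiffBump c) {ε : ℝ} (hε : 0 < ε) : ∃ L : Finset (L2 Ω), ∀ x ∈ closure Ω, ∀ u : L2 Ω,
      ∃ g ∈ L, |∫ z in Ω, b.normed volume (z - x) * u z| ≤ |⟪g, u⟫| + ε * ‖u‖ := by
  have hk : ∀ x, Continuous fun z => b.normed volume (z - x) := fun x =>
    (b.continuous_normed (μ := volume)).comp (by fun_prop)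
  have hm : ∀ x, MemLp (fun z => b.normed volume (z - x)) 2 (volume.restrict Ω) := fun x =>
    memLp_of_continuous ho hb (hk x)
  have := isFiniteMeasure_restrict hb
  obtain ⟨K, hK⟩ := (b.contDiff_normed (μ := volume) (n := 1)).lipschitzWith_of_hasCompactSupport
    b.hasCompactSupport_normed (by simp)
  let κ : R3 → L2 Ω := fun x => (hm x).toLp _
  have hκ : Continuous κ := by
    refine continuous_iff_continuousAt.2 fun x => ?_
    rw [ContinuousAt, tendsto_iff_dist_tendsto_zero]
    have hbd : ∀ y, dist (κ y) (κ x) ≤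
        (measureUnivNNReal (volume.restrict Ω) : ℝ) ^ (ENNReal.toReal 2)⁻¹ * (K * dist y x) := by
      intro y
      rw [dist_eq_norm, ← MemLp.toLp_sub]
      refine Lp.norm_le_of_ae_bound (by positivity) ?_
      filter_upwards [((hm y).sub (hm x)).coeFn_toLp] with z hz
      rw [hz, Pi.sub_apply, ← dist_eq_norm]
      refine (hK.dist_le_mul _ _).trans_eq ?_
      rw [dist_sub_left]
    refine squeeze_zero (fun _ => dist_nonneg) hbd ?_
    have : Continuous fun y => (measureUnivNNReal (volume.restrict Ω) : ℝ) ^ (ENNReal.toReal 2)⁻¹ *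
      (K * dist y x) := by fun_prop
    simpa using this.tendsto x
  obtain ⟨t, htf, ht⟩ := Metric.totallyBounded_iff.1
    (hb.isCompact_closure.image hκ).totallyBounded ε hε
  refine ⟨htf.toFinset, fun x hx u => ?_⟩
  obtain ⟨g, hg, hxg⟩ := Set.mem_iUnion₂.1 (ht ⟨x, hx, rfl⟩)
  refine ⟨g, by simpa using hg, ?_⟩
  have e1 : ∫ z in Ω, b.normed volume (z - x) * u z = ⟪κ x, u⟫ := by
    rw [L2.inner_def]
    refine integral_congr_ae ?_
    filter_upwards [(hm x).coeFn_toLp] with z hz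
    simp only [κ, hz]
    simp [mul_comm]
  have e2 : ⟪κ x, u⟫ = ⟪g, u⟫ + ⟪κ x - g, u⟫ := by rw [inner_sub_left]; ring
  rw [e1, e2]
  refine (abs_add_le _ _).trans ?_
  gcongr
  refine (abs_real_inner_le_norm _ _).trans ?_
  gcongr
  rw [Metric.mem_ball, dist_eq_norm] at hxg
  exact hxg.le

/-- The local form of the compactness estimate: near `p`, a function differs from its means over
small balls in the inner cones by a small multiple of its gradient. -/
lemma exists_local_compactness_estimate {Ω : Set R3} (ho : IsOpen Ω) (hb : Bornology.IsBounded Ω)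
    {p e : R3} {r c s : ℝ} (hc : 0 < c) (hc1 : c ≤ 1) (hs : 0 < s) (he : ‖e‖ ≤ 1)
    (hcone : HasInnerCone Ω p e r c s) {ε : ℝ} (hε : 0 < ε) :
    ∃ (L : Finset (L2 Ω)) (C : ℝ), 0 ≤ C ∧ ∀ u ∈ restrictC1 Ω,
      ∫⁻ x in Ω ∩ Metric.ball p r, ‖fn u x‖ₑ ^ 2 ≤
        ENNReal.ofReal (C * ∑ g ∈ L, ⟪g, fn u⟫ ^ 2 + ε * ‖u‖ ^ 2) := by
  have hΩm := ho.measurableSet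
  have := isFiniteMeasure_restrict hb
  set m : ℝ := volume.real Ω with hmdef
  have hm0 : 0 ≤ m := measureReal_nonneg
  -- The radii: `8 t² ≤ ε / 2` and `4 m η² ≤ ε / 2`.
  obtain ⟨t, ht0, hts, ht1, htε⟩ : ∃ t : ℝ, 0 < t ∧ t ≤ s ∧ t ≤ 1 ∧ t ≤ ε / 16 :=
    ⟨min s (min 1 (ε / 16)), by positivity, min_le_left _ _,
      (min_le_right _ _).trans (min_le_left _ _), (min_le_right _ _).trans (min_le_right _ _)⟩
  obtain ⟨η, hη0, hη⟩ : ∃ η : ℝ, 0 < η ∧ 4 * m * η ^ 2 ≤ ε / 2 := by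
    refine ⟨Real.sqrt (ε / (8 * (m + 1))), by positivity, ?_⟩
    rw [Real.sq_sqrt (by positivity), ← mul_div_assoc, div_le_iff₀ (by positivity)]
    nlinarith
  have hct : 0 < c * t := by positivity
  let b : ContDiffBump (t • e) := ⟨c * t / 2, c * t, by positivity, by linarith⟩
  obtain ⟨L, hL⟩ := exists_finset_bump_test ho hb b hη0
  refine ⟨L, 4 * m, by positivity, ?_⟩
  rintro u ⟨φ, hφ, h1, h2⟩
  obtain ⟨k1, k2⟩ := lintegral_of_mem_restrictC1 h1 h2
  set A := Ω ∩ Metric.ball p r with hA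
  have hAm : MeasurableSet A := hΩm.inter Metric.isOpen_ball.measurableSet
  have hte : ‖t • e‖ ≤ t := by
    rw [norm_smul, Real.norm_of_nonneg ht0.le]; nlinarith
  have hball : ∀ y ∈ Metric.ball (t • e) b.rOut, ‖y‖ ≤ 2 * t := by
    intro y hy
    have hy' : dist y (t • e) < c * t := hy
    have := dist_triangle y (t • e) 0
    rw [dist_zero_right, dist_zero_right] at this
    nlinarith
  have hseg : ∀ y ∈ Metric.ball (t • e) b.rOut, ∀ x ∈ A, ∀ σ ∈ Set.Ioc (0 : ℝ) 1,
      x + σ • y ∈ Ω := by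
    rintro y hy x ⟨hx, hxr⟩ σ ⟨hσ0, hσ1⟩
    have hy' : dist y (t • e) < c * t := hy
    refine hcone x ⟨subset_closure hx, hxr⟩ (σ * t) ⟨by positivity, by nlinarith⟩ ?_
    rw [Metric.mem_closedBall, dist_add_left, mul_smul, dist_smul₀, Real.norm_of_nonneg hσ0.le]
    nlinarith
  have hli : LocallyIntegrable φ volume := hφ.continuous.locallyIntegrable
  have hdev : ∫⁻ x in A, ‖bumpAverage b φ x - φ x‖ₑ ^ 2 ≤
      ENNReal.ofReal ((2 * t) ^ 2 * ‖grad u‖ ^ 2) := by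
    refine lintegral_bumpAverage_sub_le b hφ.continuous.stronglyMeasurable hli fun y hy => ?_
    refine (lintegral_translate_sub_le hφ hAm hΩm y (hseg y hy)).trans ?_
    rw [k2, ENNReal.ofReal_mul (by positivity), ENNReal.ofReal_pow (p := 2 * t) (by positivity)]
    gcongr
    rw [← ofReal_norm]
    exact ENNReal.ofReal_le_ofReal (hball y hy)
  have havg : ∀ x ∈ A, bumpAverage b φ x = ∫ z in Ω, b.normed volume (z - x) * fn u z := by
    intro x hx
    have hsub : Metric.closedBall (x + t • e) b.rOut ⊆ Ω :=
      hcone x ⟨subset_closure hx.1, hx.2⟩ t ⟨ht0, hts⟩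
    rw [bumpAverage_eq, ← setIntegral_eq_integral_of_tsupport (Ω := Ω)
      (ψ := fun z => b.normed volume (z - x)) ((tsupport_normed_sub b x).le.trans hsub)
      (by intro z hz; simp only at hz; simp [hz])]
    refine integral_congr_ae ?_
    filter_upwards [h1] with z hz
    rw [hz, smul_eq_mul]
  set Q : ℝ := ∑ g ∈ L, ⟪g, fn u⟫ ^ 2 with hQ
  have hQ0 : 0 ≤ Q := Finset.sum_nonneg fun _ _ => sq_nonneg _
  have hmean : ∀ x ∈ A, ‖bumpAverage b φ x‖ₑ ^ 2 ≤
      ENNReal.ofReal (2 * Q + 2 * η ^ 2 * ‖fn u‖ ^ 2) := by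
    intro x hx
    obtain ⟨g, hg, h3⟩ := hL x (subset_closure hx.1) (fn u)
    rw [← havg x hx] at h3
    have h4 : ⟪g, fn u⟫ ^ 2 ≤ Q :=
      Finset.single_le_sum (f := fun g => ⟪g, fn u⟫ ^ 2) (fun _ _ => sq_nonneg _) hg
    rw [← ofReal_norm, ← ENNReal.ofReal_pow (norm_nonneg _), Real.norm_eq_abs]
    refine ENNReal.ofReal_le_ofReal ?_
    have h5 : |bumpAverage b φ x| ^ 2 ≤ (|⟪g, fn u⟫| + η * ‖fn u‖) ^ 2 := by gcongr
    nlinarith [sq_nonneg (|⟪g, fn u⟫| - η * ‖fn u‖), sq_abs ⟪g, fn u⟫]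
  have hvol : volume A ≤ ENNReal.ofReal m := by
    rw [hmdef, ofReal_measureReal (by simpa using hb.measure_lt_top.ne)]
    exact measure_mono Set.inter_subset_left
  calc ∫⁻ x in A, ‖fn u x‖ₑ ^ 2 = ∫⁻ x in A, ‖φ x‖ₑ ^ 2 := by
        refine lintegral_congr_ae ?_
        filter_upwards [ae_mono (Measure.restrict_mono_set volume Set.inter_subset_left) h1]
          with x hx
        rw [hx]
    _ ≤ ∫⁻ x in A, (ENNReal.ofReal (2 * (2 * Q + 2 * η ^ 2 * ‖fn u‖ ^ 2)) +
          2 * ‖bumpAverage b φ x - φ x‖ₑ ^ 2) := by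
        refine setLIntegral_mono' hAm fun x hx => ?_
        rw [ENNReal.ofReal_mul (by norm_num)]
        calc ‖φ x‖ₑ ^ 2 = ‖bumpAverage b φ x + -(bumpAverage b φ x - φ x)‖ₑ ^ 2 := by
              congr 2; ring
          _ ≤ 2 * ‖bumpAverage b φ x‖ₑ ^ 2 + 2 * ‖bumpAverage b φ x - φ x‖ₑ ^ 2 := by
              rw [← enorm_neg (bumpAverage b φ x - φ x)]
              exact enorm_add_sq_le _ _
          _ ≤ _ := by
              gcongr
              · simp
              · exact hmean x hx
    _ = ENNReal.ofReal (2 * (2 * Q + 2 * η ^ 2 * ‖fn u‖ ^ 2)) * volume A +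
          2 * ∫⁻ x in A, ‖bumpAverage b φ x - φ x‖ₑ ^ 2 := by
        rw [lintegral_add_left measurable_const, setLIntegral_const,
          lintegral_const_mul' _ _ (by simp)]
    _ ≤ ENNReal.ofReal (2 * (2 * Q + 2 * η ^ 2 * ‖fn u‖ ^ 2)) * ENNReal.ofReal m +
          ENNReal.ofReal 2 * ENNReal.ofReal ((2 * t) ^ 2 * ‖grad u‖ ^ 2) := by
        gcongr
        simp
    _ = ENNReal.ofReal (2 * (2 * Q + 2 * η ^ 2 * ‖fn u‖ ^ 2) * m +
          2 * ((2 * t) ^ 2 * ‖grad u‖ ^ 2)) := by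
        rw [← ENNReal.ofReal_mul (by positivity), ← ENNReal.ofReal_mul (by positivity),
          ENNReal.ofReal_add (by positivity) (by positivity)]
    _ ≤ _ := by
        refine ENNReal.ofReal_le_ofReal ?_
        have e1 : ‖fn u‖ ^ 2 ≤ ‖u‖ ^ 2 := by gcongr; exact norm_fn_le u
        have e2 : ‖grad u‖ ^ 2 ≤ ‖u‖ ^ 2 := by gcongr; exact norm_grad_le u
        have e3 : 8 * t ^ 2 ≤ ε / 2 := by nlinarith
        have e4 : 4 * m * η ^ 2 * ‖fn u‖ ^ 2 ≤ ε / 2 * ‖u‖ ^ 2 := by gcongr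
        have e5 : 8 * t ^ 2 * ‖grad u‖ ^ 2 ≤ ε / 2 * ‖u‖ ^ 2 := by gcongr
        nlinarith

/-- Rellich's theorem in the form of an inequality: up to a small multiple of the `H¹` norm,
finitely many linear functionals control the `L²` norm. -/
lemma IsSmoothBoundedDomain.exists_compactness_estimate {Ω : Set R3}
    (hΩ : IsSmoothBoundedDomain Ω) {ε : ℝ} (hε : 0 < ε) :
    ∃ (L : Finset (L2 Ω)) (C : ℝ), 0 ≤ C ∧ ∀ u : H1 Ω,
      ‖fn u‖ ^ 2 ≤ C * ∑ g ∈ L, ⟪g, fn u⟫ ^ 2 + ε * ‖u‖ ^ 2 := by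
  classical
  let P : Set R3 → Prop := fun A => ∀ ε > 0, ∃ (L : Finset (L2 Ω)) (C : ℝ), 0 ≤ C ∧
    ∀ u ∈ restrictC1 Ω, ∫⁻ x in Ω ∩ A, ‖fn u x‖ₑ ^ 2 ≤
        ENNReal.ofReal (C * ∑ g ∈ L, ⟪g, fn u⟫ ^ 2 + ε * ‖u‖ ^ 2)
  have hP : P (closure Ω) := by
    refine hΩ.isBounded.isCompact_closure.induction_on ?_ ?_ ?_ ?_
    · exact fun ε _ => ⟨∅, 0, le_rfl, fun u _ => by simp⟩
    · intro A B hAB hB ε hε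
      obtain ⟨L, C, hC, h⟩ := hB ε hε
      exact ⟨L, C, hC, fun u hu =>
        (lintegral_mono_set (Set.inter_subset_inter_right _ hAB)).trans (h u hu)⟩
    · intro A B hA hB ε hε
      obtain ⟨L, C, hC, h⟩ := hA (ε / 2) (by positivity)
      obtain ⟨L', C', hC', h'⟩ := hB (ε / 2) (by positivity)
      refine ⟨L ∪ L', C + C', by positivity, fun u hu => ?_⟩
      have hs : ∑ g ∈ L, ⟪g, fn u⟫ ^ 2 ≤ ∑ g ∈ L ∪ L', ⟪g, fn u⟫ ^ 2 :=
        Finset.sum_le_sum_of_subset_of_nonneg Finset.subset_union_left fun _ _ _ => sq_nonneg _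
      have hs' : ∑ g ∈ L', ⟪g, fn u⟫ ^ 2 ≤ ∑ g ∈ L ∪ L', ⟪g, fn u⟫ ^ 2 :=
        Finset.sum_le_sum_of_subset_of_nonneg Finset.subset_union_right fun _ _ _ => sq_nonneg _
      have p1 : 0 ≤ ∑ g ∈ L, ⟪g, fn u⟫ ^ 2 := Finset.sum_nonneg fun _ _ => sq_nonneg _
      have p2 : 0 ≤ ∑ g ∈ L', ⟪g, fn u⟫ ^ 2 := Finset.sum_nonneg fun _ _ => sq_nonneg _
      rw [Set.inter_union_distrib_left]
      refine (lintegral_union_le _ _ _).trans ((add_le_add (h u hu) (h' u hu)).trans ?_)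
      rw [← ENNReal.ofReal_add (by positivity) (by positivity)]
      refine ENNReal.ofReal_le_ofReal ?_
      nlinarith [mul_le_mul_of_nonneg_left hs hC, mul_le_mul_of_nonneg_left hs' hC']
    · intro p hp
      obtain ⟨r, hr, c, hc, s, hs, e, he, hc1, hcone⟩ := hΩ.exists_cone hp
      exact ⟨Metric.ball p r, mem_nhdsWithin_of_mem_nhds (Metric.ball_mem_nhds p hr),
        fun ε hε => exists_local_compactness_estimate hΩ.isOpen hΩ.isBounded hc hc1 hs he hcone hε⟩
  obtain ⟨L, C, hC, h⟩ := hP ε hε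
  refine ⟨L, C, hC, ?_⟩
  have hc1 := continuous_fn Ω
  refine le_of_forall_mem_restrictC1 hΩ (by fun_prop) (by fun_prop) fun u hu => ?_
  have h1 := h u hu
  rw [Set.inter_eq_left.2 subset_closure, lintegral_enorm_sq_Lp] at h1
  refine (ENNReal.ofReal_le_ofReal_iff ?_).1 h1
  have : 0 ≤ ∑ g ∈ L, ⟪g, fn u⟫ ^ 2 := Finset.sum_nonneg fun _ _ => sq_nonneg _
  positivity

/-- Rellich's theorem for the trace and the inclusion into `L²(Ω)`, combined: a bounded set of
`H¹(Ω)` on which the `L²(Ω)` and `L²(Γ)` distances control the `H¹` distance is totally bounded. -/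
lemma IsSmoothBoundedDomain.totallyBounded_of_norm_sq_le {Ω : Set R3}
    (hΩ : IsSmoothBoundedDomain Ω) {S : Set (H1 Ω)} {R M : ℝ} (hR : ∀ u ∈ S, ‖u‖ ≤ R)
    (h : ∀ u ∈ S, ∀ v ∈ S, ‖u - v‖ ^ 2 ≤ M * (‖fn (u - v)‖ + ‖trace Ω (u - v)‖)) :
    TotallyBounded S := by
  rw [Metric.totallyBounded_iff]
  intro ε hε
  rcases S.eq_empty_or_nonempty with rfl | ⟨u₀, hu₀⟩
  · exact ⟨∅, Set.finite_empty, by simp⟩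
  have hR0 : 0 ≤ R := (norm_nonneg _).trans (hR u₀ hu₀)
  -- `κ` is the size of `‖fn d‖ + ‖trace d‖` that forces `‖d‖ < ε`, and `β ≤ κ / 3` the size of
  -- `‖fn d‖` that forces `‖trace d‖ ≤ κ / 3`.
  set κ : ℝ := ε ^ 2 / (|M| + 1) with hκ
  have hκ0 : 0 < κ := by positivity
  obtain ⟨C₁, hC₁, h₁⟩ := hΩ.norm_trace_sq_le (ε := κ ^ 2 / (18 * (4 * R ^ 2 + 1))) (by positivity)
  obtain ⟨β, hβ0, hβκ, hβ⟩ : ∃ β : ℝ, 0 < β ∧ β ≤ κ / 3 ∧ C₁ * β ^ 2 ≤ κ ^ 2 / 18 := by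
    refine ⟨min (κ / 3) (Real.sqrt (κ ^ 2 / (18 * (C₁ + 1)))), by positivity, min_le_left _ _, ?_⟩
    calc _ ≤ C₁ * Real.sqrt (κ ^ 2 / (18 * (C₁ + 1))) ^ 2 := by
          gcongr; exact min_le_right _ _
      _ = C₁ * (κ ^ 2 / (18 * (C₁ + 1))) := by rw [Real.sq_sqrt (by positivity)]
      _ ≤ _ := by
          rw [← mul_div_assoc, div_le_div_iff₀ (by positivity) (by norm_num)]
          nlinarith [sq_nonneg κ]
  obtain ⟨L, C₂, hC₂, h₂⟩ := hΩ.exists_compactness_estimate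
    (ε := β ^ 2 / (2 * (4 * R ^ 2 + 1))) (by positivity)
  set τ : ℝ := Real.sqrt (β ^ 2 / (2 * (C₂ + 1) * (L.card + 1))) with hτ
  have hτ0 : 0 < τ := by positivity
  let Φ : H1 Ω → (L → ℝ) := fun u g => ⟪(g : L2 Ω), fn u⟫
  have hΦb : Bornology.IsBounded (Φ '' S) := by
    refine (Metric.isBounded_closedBall (x := (0 : L → ℝ)) (r := (∑ g ∈ L, ‖g‖) * R)).subset ?_
    rintro _ ⟨u, hu, rfl⟩
    rw [mem_closedBall_zero_iff]
    have hs0 : 0 ≤ ∑ g ∈ L, ‖g‖ := Finset.sum_nonneg fun _ _ => norm_nonneg _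
    refine (pi_norm_le_iff_of_nonneg (by positivity)).2 fun g => ?_
    refine (norm_inner_le_norm _ _).trans ?_
    gcongr
    · exact Finset.single_le_sum (f := fun g : L2 Ω => ‖g‖) (fun _ _ => norm_nonneg _) g.2
    · exact (norm_fn_le u).trans (hR u hu)
  have hΦt : TotallyBounded (Φ '' S) :=
    hΦb.isCompact_closure.totallyBounded.subset subset_closure
  obtain ⟨t, htS, htf, ht⟩ := Set.exists_subset_image_finite_and.1
    (Metric.finite_approx_of_totallyBounded hΦt τ hτ0)
  refine ⟨t, htf, fun u hu => ?_⟩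
  obtain ⟨y, hy, huy⟩ := Set.mem_iUnion₂.1 (ht ⟨u, hu, rfl⟩)
  obtain ⟨v, hv, rfl⟩ := hy
  refine Set.mem_iUnion₂.2 ⟨v, hv, ?_⟩
  rw [Metric.mem_ball, dist_eq_norm]
  have hd : ‖u - v‖ ^ 2 ≤ 4 * R ^ 2 := by
    have h3 : ‖u - v‖ ≤ 2 * R :=
      (norm_sub_le _ _).trans (by linarith [hR u hu, hR v (htS hv)])
    nlinarith [norm_nonneg (u - v)]
  have hsum : ∑ g ∈ L, ⟪g, fn (u - v)⟫ ^ 2 ≤ (L.card + 1) * τ ^ 2 := by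
    have h3 : ∀ g ∈ L, ⟪g, fn (u - v)⟫ ^ 2 ≤ τ ^ 2 := by
      intro g hg
      have h4 : dist (Φ u ⟨g, hg⟩) (Φ v ⟨g, hg⟩) < τ := (dist_le_pi_dist _ _ _).trans_lt huy
      have h5 : Φ u ⟨g, hg⟩ - Φ v ⟨g, hg⟩ = ⟪g, fn (u - v)⟫ := (inner_sub_right _ _ _).symm
      rw [Real.dist_eq, h5] at h4
      rw [← sq_abs]
      gcongr
    refine (Finset.sum_le_card_nsmul _ _ _ h3).trans ?_
    rw [nsmul_eq_mul]
    nlinarith [sq_nonneg τ]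
  have hfn : ‖fn (u - v)‖ ≤ β := by
    refine abs_le_of_sq_le_sq' ?_ hβ0.le |>.2
    refine (h₂ (u - v)).trans ?_
    have e1 : C₂ * ∑ g ∈ L, ⟪g, fn (u - v)⟫ ^ 2 ≤ β ^ 2 / 2 := by
      calc _ ≤ C₂ * ((L.card + 1) * τ ^ 2) := by gcongr
        _ = C₂ / (C₂ + 1) * (β ^ 2 / 2) := by
          rw [hτ, Real.sq_sqrt (by positivity)]
          field_simp
        _ ≤ 1 * (β ^ 2 / 2) := by
          gcongr
          rw [div_le_one (by positivity)]
          linarith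
        _ = _ := one_mul _
    have e2 : β ^ 2 / (2 * (4 * R ^ 2 + 1)) * ‖u - v‖ ^ 2 ≤ β ^ 2 / 2 := by
      rw [div_mul_eq_mul_div, div_le_div_iff₀ (by positivity) (by norm_num)]
      nlinarith [sq_nonneg β]
    linarith
  have htr : ‖trace Ω (u - v)‖ ≤ κ / 3 := by
    refine abs_le_of_sq_le_sq' ?_ (by positivity) |>.2
    refine (h₁ (u - v)).trans ?_
    have e1 : C₁ * ‖fn (u - v)‖ ^ 2 ≤ κ ^ 2 / 18 := le_trans (by gcongr) hβ
    have e2 : κ ^ 2 / (18 * (4 * R ^ 2 + 1)) * ‖u - v‖ ^ 2 ≤ κ ^ 2 / 18 := by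
      rw [div_mul_eq_mul_div, div_le_div_iff₀ (by positivity) (by norm_num)]
      nlinarith [sq_nonneg κ]
    linarith
  refine lt_of_pow_lt_pow_left₀ 2 hε.le ((h u hu v (htS hv)).trans_lt ?_)
  have hκM : κ * (|M| + 1) = ε ^ 2 := by rw [hκ]; field_simp
  calc M * (‖fn (u - v)‖ + ‖trace Ω (u - v)‖) ≤ |M| * (κ / 3 + κ / 3) := by
        gcongr
        · exact le_abs_self M
        · exact hfn.trans hβκ
    _ < ε ^ 2 := by nlinarith [abs_nonneg M]

/-! ### Superposition operators and bilinear forms -/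

lemma real_inner_eq_mul (p q : ℝ) : ⟪p, q⟫ = p * q := by simp [mul_comm]

section Nemytskii
variable {α : Type*} [MeasurableSpace α] {μ : Measure α}

/-- Multiplication by a bounded function, as an operator in `L²`. -/
lemma exists_mulOp {E : Type*} [NormedAddCommGroup E] [NormedSpace ℝ E] {m : α → ℝ}
    (hm : AEStronglyMeasurable m μ) {C : ℝ} (hC : ∀ᵐ x ∂μ, |m x| ≤ C) :
    ∃ A : Lp E 2 μ →L[ℝ] Lp E 2 μ, ∀ u, A u =ᵐ[μ] fun x => m x • u x := by
  have hb : ∀ u : Lp E 2 μ, ∀ᵐ x ∂μ, ‖m x • u x‖ ≤ C * ‖u x‖ := fun u => by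
    filter_upwards [hC] with x hx
    rw [norm_smul]
    gcongr
    exact hx
  have hmem : ∀ u : Lp E 2 μ, MemLp (fun x => m x • u x) 2 μ := fun u =>
    (Lp.memLp u).of_le_mul (hm.smul (Lp.memLp u).1) (hb u)
  let A₀ : Lp E 2 μ →ₗ[ℝ] Lp E 2 μ :=
    { toFun := fun u => (hmem u).toLp _
      map_add' := fun u v => by
        refine Lp.ext ?_
        filter_upwards [(hmem (u + v)).coeFn_toLp, (hmem u).coeFn_toLp, (hmem v).coeFn_toLp,
          Lp.coeFn_add u v, Lp.coeFn_add ((hmem u).toLp _) ((hmem v).toLp _)] with x h1 h2 h3 h4 h5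
        rw [h1, h5, Pi.add_apply, h2, h3, h4, Pi.add_apply, smul_add]
      map_smul' := fun c u => by
        refine Lp.ext ?_
        filter_upwards [(hmem (c • u)).coeFn_toLp, (hmem u).coeFn_toLp,
          Lp.coeFn_smul c u, Lp.coeFn_smul c ((hmem u).toLp _)] with x h1 h2 h3 h4
        rw [h1, RingHom.id_apply, h4, Pi.smul_apply, h2, h3, Pi.smul_apply, smul_comm] }
  refine ⟨A₀.mkContinuous C fun u => ?_, fun u => (hmem u).coeFn_toLp⟩
  refine Lp.norm_le_mul_norm_of_ae_le_mul ?_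
  filter_upwards [(hmem u).coeFn_toLp, hb u] with x h1 h2
  have h3 : A₀ u x = m x • u x := h1
  rw [h3]
  exact h2

/-- A bounded Lipschitz function acts by composition in `L²` of a finite measure, as a bounded
Lipschitz map. -/
lemma exists_superposition [IsFiniteMeasure μ] {j : ℝ → ℝ} {K : ℝ} (hj : Continuous j)
    (hb : ∀ s, |j s| ≤ K) (hl : ∀ s t, |j s - j t| ≤ K * |s - t|) :
    ∃ (N : Lp ℝ 2 μ → Lp ℝ 2 μ) (C : ℝ), (∀ u, N u =ᵐ[μ] fun x => j (u x)) ∧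
      (∀ u, ‖N u‖ ≤ C) ∧ ∀ u v, ‖N u - N v‖ ≤ K * ‖u - v‖ := by
  have hmem : ∀ u : Lp ℝ 2 μ, MemLp (fun x => j (u x)) 2 μ := fun u =>
    MemLp.of_bound (hj.comp_aestronglyMeasurable (Lp.memLp u).1) K
      (Filter.Eventually.of_forall fun x => hb _)
  refine ⟨fun u => (hmem u).toLp _, (measureUnivNNReal μ : ℝ) ^ (ENNReal.toReal 2)⁻¹ * K,
    fun u => (hmem u).coeFn_toLp, fun u => ?_, fun u v => ?_⟩
  · refine Lp.norm_le_of_ae_bound (C := K) ((abs_nonneg _).trans (hb 0)) ?_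
    filter_upwards [(hmem u).coeFn_toLp] with x hx
    rw [hx]
    exact hb _
  · refine Lp.norm_le_mul_norm_of_ae_le_mul ?_
    filter_upwards [Lp.coeFn_sub ((hmem u).toLp _) ((hmem v).toLp _), (hmem u).coeFn_toLp,
      (hmem v).coeFn_toLp, Lp.coeFn_sub u v] with x h1 h2 h3 h4
    rw [h1, h4, Pi.sub_apply, Pi.sub_apply, h2, h3]
    exact hl _ _

/-- Pairing a quadratically small function with a bounded one. -/
lemma abs_inner_le_of_quadratic {r d φ : Lp ℝ 2 μ} {K M : ℝ}
    (hr : ∀ᵐ x ∂μ, |r x| ≤ K * d x ^ 2) (hφ : ∀ᵐ x ∂μ, |φ x| ≤ M) :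
    |⟪r, φ⟫| ≤ K * M * ‖d‖ ^ 2 := by
  have hint : Integrable (fun x => d x ^ 2) μ := (Lp.memLp d).integrable_sq
  have hd : ‖d‖ ^ 2 = ∫ x, d x ^ 2 ∂μ := by
    rw [← real_inner_self_eq_norm_sq, L2.inner_def]
    refine integral_congr_ae (Filter.Eventually.of_forall fun x => ?_)
    simp [sq]
  rw [hd, ← integral_const_mul, L2.inner_def, ← Real.norm_eq_abs]
  refine norm_integral_le_of_norm_le (hint.const_mul _) ?_
  filter_upwards [hr, hφ] with x h1 h2
  rw [Real.norm_eq_abs]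
  rw [real_inner_eq_mul, abs_mul]
  calc |r x| * |φ x| ≤ K * d x ^ 2 * M := by
        gcongr
        exact (abs_nonneg _).trans h1
    _ = _ := by ring

end Nemytskii

/-- The bounds on `j`, `j'` and `j''` make `j` Lipschitz, with a quadratic Taylor remainder. -/
lemma IsAdmissible.exists_bounds {j : ℝ → ℝ} (hj : IsAdmissible j) : ∃ K > 0,
    (∀ s, |j s| ≤ K) ∧ (∀ s, |deriv j s| ≤ K) ∧ (∀ s t, |j s - j t| ≤ K * |s - t|) ∧
    ∀ s t, |j t - j s - deriv j s * (t - s)| ≤ K * (t - s) ^ 2 := by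
  obtain ⟨K, hK, h⟩ := hj.bounded
  have h0 : ∀ s, |j s| ≤ K := fun s => by
    linarith [h s, abs_nonneg (deriv j s), abs_nonneg (iteratedDeriv 2 j s)]
  have h1 : ∀ s, |deriv j s| ≤ K := fun s => by
    linarith [h s, abs_nonneg (j s), abs_nonneg (iteratedDeriv 2 j s)]
  have h2 : ∀ s, |deriv (deriv j) s| ≤ K := fun s => by
    have := h s
    rw [iteratedDeriv_succ, iteratedDeriv_one] at this
    linarith [abs_nonneg (j s), abs_nonneg (deriv j s)]
  have d0 : Differentiable ℝ j := hj.contDiff.differentiable (by simp)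
  have d1 : Differentiable ℝ (deriv j) :=
    ((contDiff_succ_iff_deriv (n := 1)).1 hj.contDiff).2.2.differentiable (by simp)
  have l1 : ∀ s t, |deriv j t - deriv j s| ≤ K * |t - s| := fun s t =>
    Convex.norm_image_sub_le_of_norm_deriv_le (s := Set.univ) (fun x _ => d1 x) (fun x _ => h2 x)
      convex_univ trivial trivial
  refine ⟨K, hK, h0, h1, fun s t => ?_, fun s t => ?_⟩
  · exact Convex.norm_image_sub_le_of_norm_deriv_le (s := Set.univ) (fun x _ => d0 x)
      (fun x _ => h1 x) convex_univ trivial trivial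
  · have hd : ∀ x ∈ Set.uIcc s t, HasDerivWithinAt (fun x => j x - deriv j s * x)
        (deriv j x - deriv j s) (Set.uIcc s t) x := fun x _ => by
      have h3 := (d0 x).hasDerivAt.sub ((hasDerivAt_id x).const_mul (deriv j s))
      exact (h3.congr_deriv (by simp)).hasDerivWithinAt
    have hb : ∀ x ∈ Set.uIcc s t, ‖deriv j x - deriv j s‖ ≤ K * |t - s| := fun x hx => by
      exact (l1 s x).trans (mul_le_mul_of_nonneg_left (Set.abs_sub_left_of_mem_uIcc hx) hK.le)
    have := (convex_uIcc s t).norm_image_sub_le_of_norm_hasDerivWithin_le hd hb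
      Set.left_mem_uIcc Set.right_mem_uIcc
    rw [Real.norm_eq_abs, Real.norm_eq_abs, mul_assoc, ← sq, sq_abs] at this
    convert this using 2
    ring

section Forms
variable {Ω : Set R3}

/-- `Λ` is a bounded coercive bilinear form. -/
lemma exists_bilin_Lam (hΩ : IsSmoothBoundedDomain Ω) {a : R3 → ℝ}
    (ha : ContDiffOn ℝ 1 a (closure Ω)) {a₀ a₁ : ℝ} (ha₀ : 0 < a₀)
    (hbound : ∀ x ∈ closure Ω, a₀ ≤ a x ∧ a x ≤ a₁) :
    ∃ B : H1 Ω →L[ℝ] H1 Ω →L[ℝ] ℝ, (∀ u φ, B u φ = Lam a u φ) ∧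
      ∃ c > 0, ∀ u, c * ‖u‖ ^ 2 ≤ B u u := by
  have hΩm := hΩ.isOpen.measurableSet
  have ham : AEStronglyMeasurable a (volume.restrict Ω) :=
    (ha.continuousOn.mono subset_closure).aestronglyMeasurable hΩm
  have hab : ∀ᵐ x ∂(volume.restrict Ω), a₀ ≤ a x ∧ a x ≤ a₁ := by
    filter_upwards [ae_restrict_mem hΩm] with x hx using hbound x (subset_closure hx)
  have hab' : ∀ᵐ x ∂(volume.restrict Ω), |a x| ≤ a₁ := by
    filter_upwards [hab] with x hx
    rw [abs_of_pos (ha₀.trans_le hx.1)]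
    exact hx.2
  obtain ⟨A, hA⟩ := exists_mulOp (E := R3) ham hab'
  refine ⟨(innerSL ℝ).bilinearComp (A.comp (gradL Ω)) (gradL Ω) +
    (innerSL ℝ).bilinearComp (fnL Ω) (fnL Ω), fun u φ => ?_, min a₀ 1, by positivity, fun u => ?_⟩
  · have e : ⟪A (grad u), grad φ⟫ + ⟪fn u, fn φ⟫ = Lam a u φ := by
      rw [Lam, L2.inner_def, L2.inner_def]
      congr 1
      · refine integral_congr_ae ?_
        filter_upwards [hA (grad u)] with x hx
        rw [hx, real_inner_smul_left]
      · refine integral_congr_ae (Filter.Eventually.of_forall fun x => ?_)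
        simp [mul_comm]
    exact e
  · have e : ⟪A (grad u), grad u⟫ + ⟪fn u, fn u⟫ ≥ min a₀ 1 * ‖u‖ ^ 2 := by
      have e1 : a₀ * ‖grad u‖ ^ 2 ≤ ⟪A (grad u), grad u⟫ := by
        rw [← real_inner_self_eq_norm_sq, ← real_inner_smul_left, ← sub_nonneg, ← inner_sub_left,
          L2.inner_def]
        refine integral_nonneg_of_ae ?_
        filter_upwards [hA (grad u), Lp.coeFn_sub (A (grad u)) (a₀ • grad u),
          Lp.coeFn_smul a₀ (grad u), hab] with x h1 h2 h3 h4
        rw [h2, Pi.sub_apply, h3, h1, Pi.smul_apply, ← sub_smul, real_inner_smul_left,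
          real_inner_self_eq_norm_sq]
        exact mul_nonneg (sub_nonneg.2 h4.1) (sq_nonneg _)
      rw [norm_sq_H1, real_inner_self_eq_norm_sq]
      have e2 : min a₀ 1 * ‖grad u‖ ^ 2 ≤ a₀ * ‖grad u‖ ^ 2 := by gcongr; exact min_le_left _ _
      have e3 : min a₀ 1 * ‖fn u‖ ^ 2 ≤ 1 * ‖fn u‖ ^ 2 := by gcongr; exact min_le_right _ _
      linarith
    exact e

/-- `DF₀(u)` is a bounded bilinear form. -/
lemma exists_bilin_DF0 {f g : ℝ → ℝ} (hf : IsAdmissible f) (hg : IsAdmissible g) (u : H1 Ω) :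
    ∃ D : H1 Ω →L[ℝ] H1 Ω →L[ℝ] ℝ, ∀ w φ, D w φ = DF0 f g u w φ := by
  obtain ⟨Kf, -, -, hf1, -⟩ := hf.exists_bounds
  obtain ⟨Kg, -, -, hg1, -⟩ := hg.exists_bounds
  have hfm : AEStronglyMeasurable (fun x => deriv f (fn u x)) (volume.restrict Ω) :=
    (hf.contDiff.continuous_deriv (by simp)).comp_aestronglyMeasurable (Lp.memLp (fn u)).1
  have hgm : AEStronglyMeasurable (fun x => deriv g (trace Ω u x)) (surfaceMeasure Ω) :=
    (hg.contDiff.continuous_deriv (by simp)).comp_aestronglyMeasurable (Lp.memLp (trace Ω u)).1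
  obtain ⟨A, hA⟩ := exists_mulOp (E := ℝ) hfm (Filter.Eventually.of_forall fun x => hf1 _)
  obtain ⟨A', hA'⟩ := exists_mulOp (E := ℝ) hgm (Filter.Eventually.of_forall fun x => hg1 _)
  refine ⟨(innerSL ℝ).bilinearComp (A.comp (fnL Ω)) (fnL Ω) +
    (innerSL ℝ).bilinearComp (A'.comp (trace Ω)) (trace Ω), fun w φ => ?_⟩
  have e : ⟪A (fn w), fn φ⟫ + ⟪A' (trace Ω w), trace Ω φ⟫ = DF0 f g u w φ := by
    rw [DF0, L2.inner_def, L2.inner_def]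
    congr 1
    · refine integral_congr_ae ?_
      filter_upwards [hA (fn w)] with x hx
      rw [hx, real_inner_smul_left, real_inner_eq_mul, mul_assoc]
    · refine integral_congr_ae ?_
      filter_upwards [hA' (trace Ω w)] with x hx
      rw [hx, real_inner_smul_left, real_inner_eq_mul, mul_assoc]
  exact e

end Forms

/-! ### Compactness and isolation of solutions -/

/-- Functions that are `C¹` up to the boundary have bounded values and traces. -/
lemma exists_bound_of_mem_restrictC1 {Ω : Set R3} (hΩ : IsSmoothBoundedDomain Ω) {φ : H1 Ω}
    (hφ : φ ∈ restrictC1 Ω) : ∃ M, 0 ≤ M ∧ (∀ᵐ x ∂(volume.restrict Ω), |fn φ x| ≤ M) ∧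
      ∀ᵐ x ∂(surfaceMeasure Ω), |trace Ω φ x| ≤ M := by
  obtain ⟨ψ, hψ, h1, -⟩ := hφ
  obtain ⟨M, hM, hb⟩ := exists_bound_of_isBounded hΩ.isBounded hψ.continuous
  refine ⟨M, hM, ?_, ?_⟩
  · filter_upwards [h1, ae_restrict_mem hΩ.isOpen.measurableSet] with x hx hxΩ
    rw [hx]
    exact hb x (subset_closure hxΩ)
  · rcases trace_spec Ω with htr | h0
    · filter_upwards [htr ψ hψ φ h1, (ae_restrict_mem isClosed_frontier.measurableSet :
        ∀ᵐ x ∂(surfaceMeasure Ω), x ∈ frontier Ω)] with x hx hxΓ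
      rw [hx]
      exact hb x (frontier_subset_closure hxΓ)
    · rw [h0]
      filter_upwards [Lp.coeFn_zero ℝ 2 (surfaceMeasure Ω)] with x hx
      rw [zero_apply, hx]
      simpa using hM

/-- The estimates for one of the two parts of `F₀`: the superposition operator of `j` in the `L²`
space of a finite measure, composed with an operator `V`. -/
lemma exists_superposition_estimates {α H : Type*} [MeasurableSpace α] {μ : Measure α}
    [IsFiniteMeasure μ] [NormedAddCommGroup H] [NormedSpace ℝ H] (V : H →L[ℝ] Lp ℝ 2 μ)
    {j : ℝ → ℝ} (hj : IsAdmissible j) :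
    ∃ C, 0 ≤ C ∧ (∀ u φ, |∫ x, j (V u x) * V φ x ∂μ| ≤ C * ‖V φ‖) ∧
      (∀ u v φ, |(∫ x, j (V u x) * V φ x ∂μ) - ∫ x, j (V v x) * V φ x ∂μ| ≤
        C * (‖V (u - v)‖ * ‖V φ‖)) ∧
      ∀ φ M, (∀ᵐ x ∂μ, |V φ x| ≤ M) → ∀ u v,
        |(∫ x, j (V v x) * V φ x ∂μ) - (∫ x, j (V u x) * V φ x ∂μ) -
          ∫ x, deriv j (V u x) * V (v - u) x * V φ x ∂μ| ≤ C * M * ‖V (v - u)‖ ^ 2 := by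
  obtain ⟨K, hK, h0, h1, h2, h3⟩ := hj.exists_bounds
  obtain ⟨N, C, hN, hC, hL⟩ := exists_superposition (μ := μ) hj.contDiff.continuous h0 h2
  have hC0 : 0 ≤ C := (norm_nonneg _).trans (hC 0)
  have key : ∀ u φ, ∫ x, j (V u x) * V φ x ∂μ = ⟪N (V u), V φ⟫ := fun u φ => by
    rw [L2.inner_def]
    refine integral_congr_ae ?_
    filter_upwards [hN (V u)] with x hx
    rw [hx, real_inner_eq_mul]
  refine ⟨C + K, by positivity, fun u φ => ?_, fun u v φ => ?_, fun φ M hφ u v => ?_⟩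
  · rw [key]
    refine (abs_real_inner_le_norm _ _).trans ?_
    gcongr
    linarith [hC (V u)]
  · rw [key, key, ← inner_sub_left, ← mul_assoc]
    refine (abs_real_inner_le_norm _ _).trans ?_
    gcongr
    rw [map_sub]
    refine (hL _ _).trans ?_
    gcongr
    linarith
  · have hjm : AEStronglyMeasurable (fun x => deriv j (V u x)) μ :=
      (hj.contDiff.continuous_deriv (by simp)).comp_aestronglyMeasurable (Lp.memLp (V u)).1
    obtain ⟨A, hA⟩ := exists_mulOp (E := ℝ) hjm (Filter.Eventually.of_forall fun x => h1 _)
    have e : ∫ x, deriv j (V u x) * V (v - u) x * V φ x ∂μ = ⟪A (V (v - u)), V φ⟫ := by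
      rw [L2.inner_def]
      refine integral_congr_ae ?_
      filter_upwards [hA (V (v - u))] with x hx
      rw [hx, real_inner_smul_left, real_inner_eq_mul, mul_assoc]
    rw [key, key, e, ← inner_sub_left, ← inner_sub_left]
    have hr : ∀ᵐ x ∂μ, |(N (V v) - N (V u) - A (V (v - u)) : Lp ℝ 2 μ) x| ≤
        (C + K) * V (v - u) x ^ 2 := by
      have hVs : V (v - u) = V v - V u := map_sub _ _ _
      rw [hVs]
      filter_upwards [hA (V v - V u), hN (V v), hN (V u), Lp.coeFn_sub (V v) (V u),
        Lp.coeFn_sub (N (V v)) (N (V u)),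
        Lp.coeFn_sub (N (V v) - N (V u)) (A (V v - V u))] with x k1 k2 k3 k4 k5 k6
      rw [k6, Pi.sub_apply, k5, Pi.sub_apply, k2, k3, k1, k4, Pi.sub_apply, smul_eq_mul]
      refine (h3 _ _).trans ?_
      gcongr
      linarith
    exact abs_inner_le_of_quadratic hr hφ

section Nonlinearity
variable {Ω : Set R3}

/-- Boundedness, Lipschitz continuity and second order expansion of `F₀`. The expansion is tested
only with functions that are `C¹` up to the boundary: no Sobolev embedding is needed then. -/
lemma exists_F0_estimates (hΩ : IsSmoothBoundedDomain Ω) {f g : ℝ → ℝ} (hf : IsAdmissible f)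
    (hg : IsAdmissible g) : ∃ C, 0 ≤ C ∧
      (∀ u φ : H1 Ω, |F0 f g u φ| ≤ C * (‖fn φ‖ + ‖trace Ω φ‖)) ∧
      (∀ u v φ : H1 Ω, |F0 f g u φ - F0 f g v φ| ≤
        C * (‖fn (u - v)‖ * ‖fn φ‖ + ‖trace Ω (u - v)‖ * ‖trace Ω φ‖)) ∧
      ∀ φ ∈ restrictC1 Ω, ∃ C', ∀ u v : H1 Ω,
        |F0 f g v φ - F0 f g u φ - DF0 f g u (v - u) φ| ≤ C' * ‖v - u‖ ^ 2 := by
  have := isFiniteMeasure_restrict hΩ.isBounded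
  have := hΩ.isFiniteMeasure_surfaceMeasure
  obtain ⟨C₁, hC₁, a1, a2, a3⟩ := exists_superposition_estimates (fnL Ω) hf
  obtain ⟨C₂, hC₂, b1, b2, b3⟩ := exists_superposition_estimates (trace Ω) hg
  simp only [fnL_apply] at a1 a2 a3
  refine ⟨C₁ + C₂, by positivity, fun u φ => ?_, fun u v φ => ?_, fun φ hφ => ?_⟩
  · refine (abs_add_le _ _).trans ((add_le_add (a1 u φ) (b1 u φ)).trans ?_)
    nlinarith [mul_nonneg hC₁ (norm_nonneg (trace Ω φ)), mul_nonneg hC₂ (norm_nonneg (fn φ))]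
  · have e : F0 f g u φ - F0 f g v φ =
        ((∫ x in Ω, f (fn u x) * fn φ x) - ∫ x in Ω, f (fn v x) * fn φ x) +
        ((∫ x, g (trace Ω u x) * trace Ω φ x ∂(surfaceMeasure Ω)) -
          ∫ x, g (trace Ω v x) * trace Ω φ x ∂(surfaceMeasure Ω)) := by
      simp only [F0]; ring
    rw [e]
    refine (abs_add_le _ _).trans ((add_le_add (a2 u v φ) (b2 u v φ)).trans ?_)
    have p1 : 0 ≤ C₁ * (‖trace Ω (u - v)‖ * ‖trace Ω φ‖) := by positivity
    have p2 : 0 ≤ C₂ * (‖fn (u - v)‖ * ‖fn φ‖) := by positivity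
    nlinarith
  · obtain ⟨M, hM, m1, m2⟩ := exists_bound_of_mem_restrictC1 hΩ hφ
    refine ⟨C₁ * M + C₂ * M * ‖trace Ω‖ ^ 2, fun u v => ?_⟩
    have e : F0 f g v φ - F0 f g u φ - DF0 f g u (v - u) φ =
        ((∫ x in Ω, f (fn v x) * fn φ x) - (∫ x in Ω, f (fn u x) * fn φ x) -
          ∫ x in Ω, deriv f (fn u x) * fn (v - u) x * fn φ x) +
        ((∫ x, g (trace Ω v x) * trace Ω φ x ∂(surfaceMeasure Ω)) -
          (∫ x, g (trace Ω u x) * trace Ω φ x ∂(surfaceMeasure Ω)) -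
          ∫ x, deriv g (trace Ω u x) * trace Ω (v - u) x * trace Ω φ x ∂(surfaceMeasure Ω)) := by
      simp only [F0, DF0]; ring
    rw [e]
    refine (abs_add_le _ _).trans ((add_le_add (a3 φ M m1 u v) (b3 φ M m2 u v)).trans ?_)
    have q1 : ‖fn (v - u)‖ ^ 2 ≤ ‖v - u‖ ^ 2 := by gcongr; exact norm_fn_le _
    have q2 : ‖trace Ω (v - u)‖ ^ 2 ≤ ‖trace Ω‖ ^ 2 * ‖v - u‖ ^ 2 := by
      rw [← mul_pow]; gcongr; exact (trace Ω).le_opNorm _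
    have p1 : 0 ≤ C₁ * M := by positivity
    have p2 : 0 ≤ C₂ * M := by positivity
    nlinarith [mul_le_mul_of_nonneg_left q1 p1, mul_le_mul_of_nonneg_left q2 p2]

/-- `H¹(Ω)` is complete: the definition of the weak gradient passes to `L²` limits. -/
instance completeSpace_H1 : CompleteSpace (H1 Ω) := by
  have hcl : IsClosed (H1 Ω : Set (WithLp 2 (L2 Ω × L2Vec Ω))) := by
    have hset : (H1 Ω : Set (WithLp 2 (L2 Ω × L2Vec Ω))) =
        {w | IsWeakGradient Ω w.fst w.snd} := rfl
    rw [hset]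
    simp only [IsWeakGradient, Set.ofPred_forall]
    refine isClosed_iInter fun φ => isClosed_iInter fun h1 => isClosed_iInter fun h2 =>
      isClosed_iInter fun _ => isClosed_iInter fun v => ?_
    have m1 : MemLp (fun x => fderiv ℝ φ x v) 2 (volume.restrict Ω) :=
      (continuous_fderiv_test h1 v).memLp_of_hasCompactSupport (hasCompactSupport_fderiv_test h2 v)
    have c2 : Continuous fun x => φ x • v := h1.continuous.smul continuous_const
    have m2 : MemLp (fun x => φ x • v) 2 (volume.restrict Ω) :=
      c2.memLp_of_hasCompactSupport h2.smul_right
    have e1 : ∀ u : L2 Ω, ∫ x in Ω, u x * fderiv ℝ φ x v = ⟪u, m1.toLp _⟫ := fun u => by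
      rw [L2.inner_def]
      refine integral_congr_ae ?_
      filter_upwards [m1.coeFn_toLp] with x hx
      rw [hx, real_inner_eq_mul]
    have e2 : ∀ G : L2Vec Ω, ∫ x in Ω, ⟪G x, v⟫ * φ x = ⟪G, m2.toLp _⟫ := fun G => by
      rw [L2.inner_def]
      refine integral_congr_ae ?_
      filter_upwards [m2.coeFn_toLp] with x hx
      rw [hx, real_inner_smul_right, mul_comm]
    simp only [e1, e2]
    have cf : Continuous fun w : WithLp 2 (L2 Ω × L2Vec Ω) => w.fst :=
      (WithLp.fstL 2 ℝ _ _).continuous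
    have cs : Continuous fun w : WithLp 2 (L2 Ω × L2Vec Ω) => w.snd :=
      (WithLp.sndL 2 ℝ _ _).continuous
    exact isClosed_eq (cf.inner continuous_const) (cs.inner continuous_const).neg
  exact hcl.completeSpace_coe

/-- Compactness of the solution operator: the `w` for which `Λ w` is bounded by `M` as a functional
on `L²(Ω) × L²(Γ)` form a totally bounded set. -/
lemma totallyBounded_of_abs_le (hΩ : IsSmoothBoundedDomain Ω) (B : H1 Ω →L[ℝ] H1 Ω →L[ℝ] ℝ)
    {c : ℝ} (hc : 0 < c) (hB : ∀ u, c * ‖u‖ ^ 2 ≤ B u u) (M : ℝ) :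
    TotallyBounded {w : H1 Ω | ∀ φ, |B w φ| ≤ M * (‖fn φ‖ + ‖trace Ω φ‖)} := by
  refine hΩ.totallyBounded_of_norm_sq_le (R := |M| * (1 + ‖trace Ω‖) / c) (M := 2 * M / c)
    (fun u hu => ?_) fun u hu v hv => ?_
  · rw [le_div_iff₀ hc]
    have h1 := (hB u).trans ((le_abs_self _).trans (hu u))
    have h2 : M * (‖fn u‖ + ‖trace Ω u‖) ≤ |M| * (‖u‖ + ‖trace Ω‖ * ‖u‖) := by
      gcongr
      · exact le_abs_self M
      · exact norm_fn_le u
      · exact (trace Ω).le_opNorm u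
    rcases (norm_nonneg u).eq_or_lt with h0 | h0
    · rw [← h0]; simp; positivity
    · refine le_of_mul_le_mul_right ?_ h0
      nlinarith
  · have h1 := hB (u - v)
    have h2 : B (u - v) (u - v) = B u (u - v) - B v (u - v) := by
      rw [B.map_sub, sub_apply]
    have h3 := (abs_le.1 (hu (u - v))).2
    have h4 := (abs_le.1 (hv (u - v))).1
    rw [div_mul_eq_mul_div, le_div_iff₀ hc]
    nlinarith

lemma mem_solutionSet_iff {a : R3 → ℝ} {f g : ℝ → ℝ} {u : H1 Ω} :
    u ∈ solutionSet Ω a f g ↔ ∀ φ, Lam a u φ = F0 f g u φ :=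
  forall_congr' fun _ => sub_eq_zero

/-- The set of weak solutions is compact in `H¹(Ω)`. -/
lemma isCompact_solutionSet (hΩ : IsSmoothBoundedDomain Ω) {a : R3 → ℝ} {f g : ℝ → ℝ}
    (hf : IsAdmissible f) (hg : IsAdmissible g) (B : H1 Ω →L[ℝ] H1 Ω →L[ℝ] ℝ)
    (hBa : ∀ u φ, B u φ = Lam a u φ) {c : ℝ} (hc : 0 < c) (hB : ∀ u, c * ‖u‖ ^ 2 ≤ B u u) :
    IsCompact (solutionSet Ω a f g) := by
  obtain ⟨C, hC, h1, h2, -⟩ := exists_F0_estimates hΩ hf hg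
  refine TotallyBounded.isCompact_of_isClosed ?_ ?_
  · refine (totallyBounded_of_abs_le hΩ B hc hB C).subset ?_
    intro u hu φ
    rw [hBa, mem_solutionSet_iff.1 hu]
    exact h1 u φ
  · have hset : solutionSet Ω a f g = ⋂ φ, {u | B u φ = F0 f g u φ} := by
      ext u
      simp [mem_solutionSet_iff, hBa]
    rw [hset]
    refine isClosed_iInter fun φ => isClosed_eq (B.flip φ).continuous ?_
    refine continuous_iff_continuousAt.2 fun v => ?_
    rw [ContinuousAt, tendsto_iff_dist_tendsto_zero]
    refine squeeze_zero (fun _ => dist_nonneg) (fun u => h2 u v φ) ?_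
    have hc1 := continuous_fn Ω
    have : Continuous fun u : H1 Ω =>
      C * (‖fn (u - v)‖ * ‖fn φ‖ + ‖trace Ω (u - v)‖ * ‖trace Ω φ‖) := by fun_prop
    have h0 : fn (0 : H1 Ω) = 0 := rfl
    simpa [h0] using this.tendsto v

lemma finite_of_isIsolatedIn {S : Set (H1 Ω)} (hS : IsCompact S)
    (h : ∀ u ∈ S, IsIsolatedIn S u) : S.Finite := by
  choose! δ hδ hball using h
  obtain ⟨t, ht⟩ := hS.elim_nhds_subcover' (fun u _ => Metric.ball u (δ u))
    fun u hu => Metric.ball_mem_nhds u (hδ u hu)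
  refine (t.finite_toSet.image Subtype.val).subset fun v hv => ?_
  obtain ⟨u, hu, hvu⟩ := Set.mem_iUnion₂.1 (ht hv)
  have h1 : v ∈ ({(u : H1 Ω)} : Set (H1 Ω)) := hball u u.2 ▸ ⟨hv, hvu⟩
  exact ⟨u, hu, h1.symm⟩

/-- A solution with invertible linearization is isolated: if solutions `vₙ ≠ u` converge to `u`, the
normalized differences `wₙ` have a limit point `w` with `‖w‖ = 1`, in the kernel of the
linearization. -/
lemma isIsolatedIn_of_zero_notMem_spectrumOf (hΩ : IsSmoothBoundedDomain Ω) {a : R3 → ℝ}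
    {f g : ℝ → ℝ} (hf : IsAdmissible f) (hg : IsAdmissible g) (B : H1 Ω →L[ℝ] H1 Ω →L[ℝ] ℝ)
    (hBa : ∀ u φ, B u φ = Lam a u φ) {c : ℝ} (hc : 0 < c) (hB : ∀ u, c * ‖u‖ ^ 2 ≤ B u u)
    {u : H1 Ω} (hu : u ∈ solutionSet Ω a f g)
    (hspec : (0 : ℝ) ∉ spectrumOf Ω (linearization a f g u)) :
    IsIsolatedIn (solutionSet Ω a f g) u := by
  by_contra hiso
  obtain ⟨C, hC, -, h2, h3⟩ := exists_F0_estimates hΩ hf hg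
  obtain ⟨D, hD⟩ := exists_bilin_DF0 hf hg u
  have hex : ∀ n : ℕ, ∃ v ∈ solutionSet Ω a f g, v ≠ u ∧ ‖v - u‖ < 1 / ((n : ℝ) + 1) := by
    intro n
    by_contra hn
    push Not at hn
    refine hiso ⟨1 / ((n : ℝ) + 1), by positivity, ?_⟩
    refine Set.Subset.antisymm (fun v hv => ?_) ?_
    · by_contra hne
      have h4 := hn v hv.1 hne
      have h5 := hv.2
      rw [Metric.mem_ball, dist_eq_norm] at h5
      linarith
    · rintro _ rfl
      exact ⟨hu, Metric.mem_ball_self (by positivity)⟩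
  choose v hv hvu hvn using hex
  set t : ℕ → ℝ := fun n => ‖v n - u‖ with ht
  have ht0 : ∀ n, 0 < t n := fun n => norm_pos_iff.2 (sub_ne_zero.2 (hvu n))
  have htlim : Filter.Tendsto t Filter.atTop (nhds 0) :=
    squeeze_zero (fun n => (ht0 n).le) (fun n => (hvn n).le) tendsto_one_div_add_atTop_nhds_zero_nat
  set w : ℕ → H1 Ω := fun n => (t n)⁻¹ • (v n - u) with hw
  have hw1 : ∀ n, ‖w n‖ = 1 := fun n => by
    rw [hw, norm_smul, norm_inv, norm_norm, inv_mul_cancel₀ (ht0 n).ne']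
  have hBw : ∀ n φ, B (w n) φ = (t n)⁻¹ * (F0 f g (v n) φ - F0 f g u φ) := fun n φ => by
    rw [hw, map_smul, map_sub, smul_apply, sub_apply,
      hBa, hBa, mem_solutionSet_iff.1 (hv n), mem_solutionSet_iff.1 hu, smul_eq_mul]
  have hmem : ∀ n, w n ∈ {w : H1 Ω | ∀ φ, |B w φ| ≤
      (C * (1 + ‖trace Ω‖)) * (‖fn φ‖ + ‖trace Ω φ‖)} := by
    intro n φ
    rw [hBw, abs_mul, abs_inv, abs_of_pos (ht0 n), inv_mul_le_iff₀ (ht0 n)]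
    refine (h2 (v n) u φ).trans ?_
    have q1 : ‖fn (v n - u)‖ ≤ t n := norm_fn_le _
    have q2 : ‖trace Ω (v n - u)‖ ≤ ‖trace Ω‖ * t n := (trace Ω).le_opNorm _
    have hT := norm_nonneg (trace Ω)
    calc _ ≤ C * (t n * ‖fn φ‖ + ‖trace Ω‖ * t n * ‖trace Ω φ‖) := by gcongr
      _ ≤ C * (t n * ‖fn φ‖ + ‖trace Ω‖ * t n * ‖trace Ω φ‖) +
          C * t n * (‖trace Ω‖ * ‖fn φ‖ + ‖trace Ω φ‖) := by
          have := (ht0 n).le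
          have : 0 ≤ C * t n * (‖trace Ω‖ * ‖fn φ‖ + ‖trace Ω φ‖) := by positivity
          linarith
      _ = _ := by ring
  have htb := totallyBounded_of_abs_le hΩ B hc hB (C * (1 + ‖trace Ω‖))
  obtain ⟨w₀, -, ψ, hψ, hlim⟩ := (htb.closure.isCompact_of_isClosed
    isClosed_closure).tendsto_subseq fun n => subset_closure (hmem n)
  have hw₀ : ‖w₀‖ = 1 :=
    tendsto_nhds_unique hlim.norm (by simp [hw1])
  have hE : ∀ φ ∈ restrictC1 Ω, (B - D) w₀ φ = 0 := by
    intro φ hφ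
    obtain ⟨C', hC'⟩ := h3 φ hφ
    have l1 : Filter.Tendsto (fun n => (B - D) (w (ψ n)) φ) Filter.atTop
        (nhds ((B - D) w₀ φ)) :=
      (((B - D).flip φ).continuous.tendsto w₀).comp hlim
    have l2 : Filter.Tendsto (fun n => (B - D) (w (ψ n)) φ) Filter.atTop (nhds 0) := by
      refine squeeze_zero_norm (a := fun n => C' * t (ψ n)) (fun n => ?_) ?_
      · have e : (B - D) (w (ψ n)) φ = (t (ψ n))⁻¹ * (F0 f g (v (ψ n)) φ - F0 f g u φ -
            DF0 f g u (v (ψ n) - u) φ) := by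
          rw [sub_apply, sub_apply, hBw, hw, map_smul,
            smul_apply, hD, smul_eq_mul]
          ring
        rw [e, Real.norm_eq_abs, abs_mul, abs_inv, abs_of_pos (ht0 _), inv_mul_le_iff₀ (ht0 _)]
        refine (hC' u (v (ψ n))).trans_eq ?_
        rw [ht]; ring
      · simpa using (htlim.comp hψ.tendsto_atTop).const_mul C'
    exact tendsto_nhds_unique l1 l2
  have hker : ∀ φ, (B - D) w₀ φ = 0 := fun φ =>
    le_antisymm
      (le_of_forall_mem_restrictC1 hΩ ((B - D) w₀).continuous continuous_const
        (fun φ hφ => (hE φ hφ).le) φ)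
      (le_of_forall_mem_restrictC1 hΩ continuous_const ((B - D) w₀).continuous
        (fun φ hφ => (hE φ hφ).ge) φ)
  obtain ⟨R, -, hR⟩ := not_not.1 hspec
  have h0 : R 0 = w₀ := hR 0 w₀ fun φ => by
    have := hker φ
    rw [sub_apply, sub_apply, hBa, hD] at this
    simp [linearization, this]
  rw [← h0, map_zero, norm_zero] at hw₀
  exact zero_ne_one hw₀

end Nonlinearity

end

end LimitEquilibria

theorem proposition5p4
    (Ω : Set LimitEquilibria.R3) (hΩ : LimitEquilibria.IsSmoothBoundedDomain Ω)
    (a : LimitEquilibria.R3 → ℝ) (ha : ContDiffOn ℝ 1 a (closure Ω))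
    (a₀ a₁ : ℝ) (ha₀ : 0 < a₀) (hbound : ∀ x ∈ closure Ω, a₀ ≤ a x ∧ a x ≤ a₁)
    (f g : ℝ → ℝ) (hf : LimitEquilibria.IsAdmissible f) (hg : LimitEquilibria.IsAdmissible g) :
    ((∀ u ∈ LimitEquilibria.solutionSet Ω a f g,
        LimitEquilibria.IsIsolatedIn (LimitEquilibria.solutionSet Ω a f g) u) →
      (LimitEquilibria.solutionSet Ω a f g).Finite) ∧
    ((∀ u ∈ LimitEquilibria.solutionSet Ω a f g,
        (0 : ℝ) ∉ LimitEquilibria.spectrumOf Ω (LimitEquilibria.linearization a f g u)) →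
      (LimitEquilibria.solutionSet Ω a f g).Finite) := by
  obtain ⟨B, hBa, c, hc, hB⟩ := LimitEquilibria.exists_bilin_Lam hΩ ha ha₀ hbound
  have hcpt := LimitEquilibria.isCompact_solutionSet hΩ hf hg B hBa hc hB
  refine ⟨LimitEquilibria.finite_of_isIsolatedIn hcpt, fun h => ?_⟩
  exact LimitEquilibria.finite_of_isIsolatedIn hcpt fun u hu =>
    LimitEquilibria.isIsolatedIn_of_zero_notMem_spectrumOf hΩ hf hg B hBa hc hB hu (h u hu)
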